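/- Let $k\ge 1$ and let $X$ be a $k$-star, i.e. a compact metric space that is the union $X=\bigcup_{j=1}^k I_j$ of $k$ arcs $I_j$ (the edges; each is homeomorphic to $[0,1]$) having a common endpoint $b$ and such that $I_i\cap I_j=\{b\}$ for $i\ne j$. Let $f:X\to X$ be a homeomorphism. A point $x\in X$ is called wandering if it has a neighbourhood $U$ with $f^n(U)\cap U=\emptyset$ for all $n\ge 1$. Let $C(X)$ be the space of nonempty closed connected subsets of $X$ with the Hausdorff metric, and let $C(f):C(X)\to C(X)$, $K\mapsto f(K)$, be the induced map. For a continuous self-map $g$ of a compact metric space $(Z,d)$, the polynomial entropy of $g$ is $$h_{\mathrm{pol}}(g)=\lim_{\varepsilon\to 0^+}\limsup_{n\to\infty}\frac{\log \mathrm{sep}(n,\varepsilon)}{\log n},$$ where $\mathrm{sep}(n,\varepsilon)$ is the maximal cardinality of a finite set $E\subset Z$ with $\max_{0\le i\le n-1}d(g^i(x),g^i(y))\ge\varepsilon$ for all $x\neq y$ in $E$. If exactly $l\le k$ of the edges $I_1,\dots,I_k$ contain a wandering point of $f$, then $h_{\mathrm{pol}}(C(f))=\max\{l,2\}$ if $l\ge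 1$, and $h_{\mathrm{pol}}(C(f))=0$ if $l=0$. -/

import Mathlib

open Filter Topology TopologicalSpace Set

noncomputable section

/-- The dynamic (pseudo)metric `d_n^f(x, y) = max_{0 ≤ i ≤ n - 1} d(f^i x, f^i y)`. -/
def dynDist {Z : Type*} [PseudoMetricSpace Z] (f : Z → Z) (n : ℕ) (x y : Z) : ℝ :=
  ⨆ i : Fin n, dist (f^[i] x) (f^[i] y)

/-- A finite set `E` is `(f, n, ε)`-separated if distinct points of `E` are at `d_n^f`-distance
at least `ε`. -/
def IsDynSeparated {Z : Type*} [PseudoMetricSpace Z] (f : Z → Z) (n : ℕ) (ε : ℝ)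
    (E : Finset Z) : Prop :=
  ∀ x ∈ E, ∀ y ∈ E, x ≠ y → ε ≤ dynDist f n x y

/-- `sep(f, n, ε)`: the maximal cardinality of a finite `(f, n, ε)`-separated set
(`⊤` if these cardinalities are unbounded). -/
def sepCard {Z : Type*} [PseudoMetricSpace Z] (f : Z → Z) (n : ℕ) (ε : ℝ) : ℕ∞ :=
  ⨆ E : {E : Finset Z // IsDynSeparated f n ε E}, ((E : Finset Z).card : ℕ∞)

/-- `limsup_{n → ∞} log sep(f, n, ε) / log n`. -/
def polGrowth {Z : Type*} [PseudoMetricSpace Z] (f : Z → Z) (ε : ℝ) : EReal :=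
  limsup (fun n : ℕ => ENNReal.log (sepCard f n ε : ENNReal) / ((Real.log n : ℝ) : EReal)) atTop

/-- The polynomial entropy `lim_{ε → 0⁺} limsup_{n → ∞} log sep(f, n, ε) / log n`. The inner
quantity is antitone in `ε`, so the limit is a supremum; see `tendsto_polEntropy`. -/
def polEntropy {Z : Type*} [PseudoMetricSpace Z] (f : Z → Z) : EReal :=
  ⨆ (ε : ℝ) (_ : 0 < ε), polGrowth f ε

theorem sepCard_antitone {Z : Type*} [PseudoMetricSpace Z] (f : Z → Z) (n : ℕ) :
    Antitone (sepCard f n) := by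
  intro a b hab
  refine iSup_le fun E => ?_
  exact le_iSup (fun E : {E : Finset Z // IsDynSeparated f n a E} => ((E : Finset Z).card : ℕ∞))
    ⟨E.1, fun x hx y hy hxy => hab.trans (E.2 x hx y hy hxy)⟩

theorem polGrowth_antitone {Z : Type*} [PseudoMetricSpace Z] (f : Z → Z) :
    Antitone (polGrowth f) := by
  intro a b hab
  refine limsup_le_limsup (Eventually.of_forall fun n => ?_)
  refine EReal.div_le_div_right_of_nonneg ?_ ?_
  · exact_mod_cast Real.log_natCast_nonneg n
  · exact ENNReal.log_monotone (by exact_mod_cast sepCard_antitone f n hab)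

theorem tendsto_polEntropy {Z : Type*} [PseudoMetricSpace Z] (f : Z → Z) :
    Tendsto (polGrowth f) (𝓝[>] 0) (𝓝 (polEntropy f)) := by
  refine tendsto_order.2 ⟨fun a ha => ?_, fun a ha => ?_⟩
  · obtain ⟨ε, hε⟩ := lt_iSup_iff.1 ha
    obtain ⟨h0, hε⟩ := lt_iSup_iff.1 hε
    filter_upwards [Ioo_mem_nhdsGT h0] with δ hδ
    exact hε.trans_le (polGrowth_antitone f hδ.2.le)
  · filter_upwards [self_mem_nhdsWithin] with δ hδ
    exact (le_iSup₂ (f := fun (ε : ℝ) (_ : 0 < ε) => polGrowth f ε) δ hδ).trans_lt ha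

/-- A point is wandering if it has a neighbourhood `U` with `f^n(U) ∩ U = ∅` for all `n ≥ 1`. -/
def IsWanderingPt {X : Type*} [TopologicalSpace X] (f : X → X) (x : X) : Prop :=
  ∃ U ∈ 𝓝 x, ∀ n : ℕ, 1 ≤ n → f^[n] '' U ∩ U = ∅

/-- The hyperspace `C(X)` of subcontinua of `X`, with the Hausdorff metric that it inherits
from the space of nonempty compact subsets. -/
abbrev Subcontinua (X : Type*) [MetricSpace X] : Type _ :=
  {K : NonemptyCompacts X // IsConnected (K : Set X)}

/-- The induced map `C(f) : C(X) → C(X)`, `K ↦ f(K)`. -/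
def inducedMap {X : Type*} [MetricSpace X] (f : X → X) (hf : Continuous f)
    (K : Subcontinua X) : Subcontinua X :=
  ⟨K.1.map f hf, by
    rw [NonemptyCompacts.coe_map]
    exact K.2.image f hf.continuousOn⟩

/-- `X` is a star (a simple `k`-od) with centre `b` and edges `I j`, `j < k`: it is the union of
the `k` arcs `I j`, each having `b` as an endpoint, any two of which meet only at `b`. -/
structure IsStar {X : Type*} [TopologicalSpace X] {k : ℕ} (b : X) (I : Fin k → Set X) :
    Prop where
  arc : ∀ j, ∃ h : unitInterval ≃ₜ I j, (h 0 : X) = b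
  inter : ∀ i j, i ≠ j → I i ∩ I j = {b}
  cover : ⋃ j, I j = univ

end

/-! Choose `N` so that `F = f ^ N` fixes the centre and preserves every edge. On each edge `F` is
increasing in the level `u j`, so the orbit of a moved point has strictly monotone levels.

Upper bound (`polEntropy_inducedMap_le`): up to precision `ε`, the first `n` iterates of a point on
an edge take O(n) patterns if `F` moves a point of that edge and O(1) otherwise. A subcontinuum
through `b` is determined by its tip on each edge, giving O(n^l) classes; any other one is an arc in
one edge with two ends, giving O(n^2) if that edge is moved and O(1) if not.

Lower bound: placing the tips independently at `F ^ (-v j)` of a moved point, with `v j < n`, gives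
n^l separated subcontinua (`card_moved_le_polEntropy`); subarcs of one moved edge, with both ends
placed this way, give n^2 (`two_le_polEntropy`).

For `k ≥ 3` the centre is topologically distinguished, `N` is the order of the edge permutation, and
an edge is moved by `F` exactly when it contains a wandering point (`exists_wandering_iff`). For `k
≤ 2` the space is an arc; it is treated as a one-edge star based at an endpoint with `N = 2`, and
`max l 2 = 2`. -/

theorem Homeomorph.coe_pow_eq_iterate {X : Type*} [TopologicalSpace X] (f : X ≃ₜ X) (n : ℕ) :
    ⇑(f ^ n) = f^[n] := by
  induction n with
  | zero => rfl
  | succ n ih => rw [pow_succ, Function.iterate_succ, ← ih]; rfl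

/-! ### Polynomial entropy from polynomial bounds on separated sets -/

section Growth

variable {Z : Type*} [PseudoMetricSpace Z]

theorem dynDist_le {f : Z → Z} {n : ℕ} {x y : Z} {r : ℝ} (hr : 0 ≤ r)
    (h : ∀ i < n, dist (f^[i] x) (f^[i] y) ≤ r) : dynDist f n x y ≤ r :=
  Real.iSup_le (fun i => h i i.2) hr

theorem dist_iterate_le_dynDist (f : Z → Z) {n i : ℕ} (hi : i < n) (x y : Z) :
    dist (f^[i] x) (f^[i] y) ≤ dynDist f n x y :=
  le_ciSup (f := fun i : Fin n => dist (f^[i] x) (f^[i] y)) (Set.finite_range _).bddAbove ⟨i, hi⟩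

/-- A family of pairwise separated points bounds `sepCard` from below. -/
theorem card_le_sepCard {ι : Type*} (s : Finset ι) (φ : ι → Z) {f : Z → Z} {n : ℕ} {ε : ℝ}
    (hε : 0 < ε) (h : ∀ a ∈ s, ∀ c ∈ s, a ≠ c → ∃ i < n, ε ≤ dist (f^[i] (φ a)) (f^[i] (φ c))) :
    (s.card : ℕ∞) ≤ sepCard f n ε := by
  classical
  have hinj : Set.InjOn φ s := by
    intro a ha c hc hac
    by_contra hne
    obtain ⟨i, -, hi⟩ := h a ha c hc hne
    rw [hac, dist_self] at hi
    linarith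
  rw [← Finset.card_image_of_injOn hinj]
  refine le_iSup (fun E : {E : Finset Z // IsDynSeparated f n ε E} => ((E : Finset Z).card : ℕ∞))
    ⟨s.image φ, ?_⟩
  intro x hx y hy hxy
  obtain ⟨a, ha, rfl⟩ := Finset.mem_image.1 hx
  obtain ⟨c, hc, rfl⟩ := Finset.mem_image.1 hy
  obtain ⟨i, hin, hi⟩ := h a ha c hc (fun h => hxy (h ▸ rfl))
  exact hi.trans (dist_iterate_le_dynDist f hin _ _)

theorem polEntropy_le_of_sepCard_le {f : Z → Z} {D : ℕ}
    (h : ∀ ε : ℝ, 0 < ε → ∃ C : ℕ, ∀ n : ℕ, 1 ≤ n → sepCard f n ε ≤ ((C * n ^ D : ℕ) : ℕ∞)) :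
    polEntropy f ≤ (D : EReal) := by
  refine iSup₂_le fun ε hε => ?_
  obtain ⟨C, hC⟩ := h ε hε
  -- `C + 1` keeps the argument of the logarithm positive when `C = 0`; its contribution vanishes
  -- after division by `log n`.
  have hlim : Tendsto (fun n : ℕ => (((Real.log (C + 1) + D * Real.log n) / Real.log n : ℝ) : EReal))
      atTop (𝓝 ((D : ℝ) : EReal)) := by
    refine (continuous_coe_real_ereal.tendsto _).comp ?_
    have h1 : Tendsto (fun n : ℕ => Real.log (n : ℝ)) atTop atTop :=
      Real.tendsto_log_atTop.comp tendsto_natCast_atTop_atTop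
    have h2 : Tendsto (fun n : ℕ => Real.log (C + 1) / Real.log (n : ℝ) + D) atTop (𝓝 (0 + D)) :=
      (h1.const_div_atTop _).add_const _
    rw [zero_add] at h2
    refine h2.congr' ?_
    filter_upwards [h1.eventually_gt_atTop 0] with n hn
    field_simp
  have : ((D : ℝ) : EReal) = (D : EReal) := by simp
  rw [← this, ← hlim.limsup_eq]
  refine limsup_le_limsup ?_
  filter_upwards [eventually_ge_atTop 1] with n hn
  have hn0 : (0 : ℝ) < n := by exact_mod_cast hn
  rw [EReal.coe_div]
  refine EReal.div_le_div_right_of_nonneg ?_ ?_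
  · exact_mod_cast Real.log_natCast_nonneg n
  · have hpos : (0 : ℝ) < (C + 1) * (n : ℝ) ^ D := by positivity
    have hlog : Real.log (C + 1) + D * Real.log n = Real.log ((C + 1) * (n : ℝ) ^ D) := by
      rw [Real.log_mul (by positivity) (by positivity), Real.log_pow]
    rw [hlog, ← ENNReal.log_ofReal_of_pos hpos]
    refine ENNReal.log_monotone ?_
    have h1 : sepCard f n ε ≤ (((C + 1) * n ^ D : ℕ) : ℕ∞) :=
      (hC n hn).trans (by gcongr; omega)
    have h2 : ENNReal.ofReal ((C + 1) * (n : ℝ) ^ D) = (((((C + 1) * n ^ D : ℕ) : ℕ∞)) : ENNReal) := by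
      rw [show ((C : ℝ) + 1) * (n : ℝ) ^ D = (((C + 1) * n ^ D : ℕ) : ℝ) by push_cast; ring,
        ENNReal.ofReal_natCast]
      rfl
    rw [h2]
    exact_mod_cast h1

/-- Slowing time by the factor `N` costs nothing: `log (N * n) / log n` tends to 1, and the limsup
along multiples of `N` is at most the full limsup. This allows working with `f ^ N`. -/
theorem le_polEntropy_of_le_sepCard {f : Z → Z} {D N : ℕ} (hN : 1 ≤ N) {ε : ℝ} (hε : 0 < ε)
    (h : ∀ n : ℕ, 1 ≤ n → ((n ^ D : ℕ) : ℕ∞) ≤ sepCard f (N * n) ε) :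
    (D : EReal) ≤ polEntropy f := by
  refine le_trans ?_ (le_iSup₂ (f := fun (ε : ℝ) (_ : 0 < ε) => polGrowth f ε) ε hε)
  have hφ : Tendsto (fun n : ℕ => N * n) atTop atTop := tendsto_id.const_mul_atTop' hN
  have hlim : Tendsto (fun n : ℕ => ((D * Real.log n / Real.log ((N * n : ℕ) : ℝ) : ℝ) : EReal))
      atTop (𝓝 ((D : ℝ) : EReal)) := by
    refine (continuous_coe_real_ereal.tendsto _).comp ?_
    have h1 : Tendsto (fun n : ℕ => Real.log (n : ℝ)) atTop atTop :=
      Real.tendsto_log_atTop.comp tendsto_natCast_atTop_atTop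
    have h2 : Tendsto (fun n : ℕ => (D : ℝ) / (Real.log N / Real.log (n : ℝ) + 1)) atTop
        (𝓝 (D / (0 + 1))) :=
      tendsto_const_nhds.div ((h1.const_div_atTop _).add_const _) (by norm_num)
    rw [zero_add, div_one] at h2
    refine h2.congr' ?_
    filter_upwards [h1.eventually_gt_atTop 0, eventually_ge_atTop 1] with n hn hn1
    have hN0 : (0 : ℝ) < N := by exact_mod_cast hN
    have hn0 : (0 : ℝ) < n := by exact_mod_cast hn1
    have hlN : 0 ≤ Real.log N := Real.log_natCast_nonneg N
    push_cast
    rw [Real.log_mul hN0.ne' hn0.ne']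
    field_simp
  have hD : ((D : ℝ) : EReal) = (D : EReal) := by simp
  rw [← hD, ← hlim.limsup_eq]
  refine le_trans ?_ (limsup_le_limsup_of_le (f := map (fun n : ℕ => N * n) atTop) hφ)
  change _ ≤ limsup ((fun n : ℕ => ENNReal.log (sepCard f n ε : ENNReal) /
    ((Real.log n : ℝ) : EReal)) ∘ fun n : ℕ => N * n) atTop
  refine limsup_le_limsup ?_
  filter_upwards [eventually_ge_atTop 1] with n hn
  have hn0 : (0 : ℝ) < n := by exact_mod_cast hn
  rw [EReal.coe_div]
  refine EReal.div_le_div_right_of_nonneg ?_ ?_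
  · exact_mod_cast Real.log_natCast_nonneg _
  · have hpos : (0 : ℝ) < (n : ℝ) ^ D := by positivity
    rw [← Real.log_pow, ← ENNReal.log_ofReal_of_pos hpos]
    refine ENNReal.log_monotone ?_
    have h2 : ENNReal.ofReal ((n : ℝ) ^ D) = ((((n ^ D : ℕ) : ℕ∞)) : ENNReal) := by
      rw [← Nat.cast_pow, ENNReal.ofReal_natCast]
      rfl
    rw [h2]
    exact_mod_cast h n hn

end Growth

/-! ### The Hausdorff metric along orbits of subcontinua -/

section Hyperspace

variable {X : Type*} [MetricSpace X]

theorem coe_inducedMap_iterate (f : X → X) (hf : Continuous f) (n : ℕ) (K : Subcontinua X) :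
    (((inducedMap f hf)^[n] K).1 : Set X) = f^[n] '' (K.1 : Set X) := by
  induction n with
  | zero => simp
  | succ n ih =>
    rw [Function.iterate_succ_apply', Function.iterate_succ', Set.image_comp, ← ih]
    exact NonemptyCompacts.coe_map hf _

/-- Subcontinua whose points have close orbits are close for the dynamic metric. -/
theorem dynDist_inducedMap_le (f : X → X) (hf : Continuous f) {n : ℕ} {r : ℝ} (hr : 0 ≤ r)
    {K L : Subcontinua X}
    (h1 : ∀ x ∈ (K.1 : Set X), ∃ y ∈ (L.1 : Set X), ∀ i < n, dist (f^[i] x) (f^[i] y) ≤ r)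
    (h2 : ∀ x ∈ (L.1 : Set X), ∃ y ∈ (K.1 : Set X), ∀ i < n, dist (f^[i] x) (f^[i] y) ≤ r) :
    dynDist (inducedMap f hf) n K L ≤ r := by
  refine dynDist_le hr fun i hi => ?_
  rw [Subtype.dist_eq, Metric.NonemptyCompacts.dist_eq, coe_inducedMap_iterate, coe_inducedMap_iterate]
  refine Metric.hausdorffDist_le_of_mem_dist hr ?_ ?_
  · rintro _ ⟨x, hx, rfl⟩
    obtain ⟨y, hy, h⟩ := h1 x hx
    exact ⟨_, ⟨y, hy, rfl⟩, h i hi⟩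
  · rintro _ ⟨x, hx, rfl⟩
    obtain ⟨y, hy, h⟩ := h2 x hx
    exact ⟨_, ⟨y, hy, rfl⟩, h i hi⟩

theorem exists_dist_lt_of_dist_iterate_inducedMap_lt (f : X → X) (hf : Continuous f) {n : ℕ}
    {ε : ℝ} {K L : Subcontinua X} (h : dist ((inducedMap f hf)^[n] K) ((inducedMap f hf)^[n] L) < ε)
    {x : X} (hx : x ∈ (K.1 : Set X)) :
    ∃ y ∈ (L.1 : Set X), dist (f^[n] x) (f^[n] y) < ε := by
  rw [Subtype.dist_eq, Metric.NonemptyCompacts.dist_eq, coe_inducedMap_iterate,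
    coe_inducedMap_iterate] at h
  have hc : Continuous f^[n] := hf.iterate n
  obtain ⟨_, ⟨y, hy, rfl⟩, hxy⟩ := Metric.exists_dist_lt_of_hausdorffDist_lt
    (Set.mem_image_of_mem _ hx) h
    (Metric.hausdorffEDist_ne_top_of_nonempty_of_bounded (K.1.nonempty.image _)
      (L.1.nonempty.image _) (K.1.isCompact.image hc).isBounded (L.1.isCompact.image hc).isBounded)
  exact ⟨y, hy, hxy⟩

end Hyperspace

/-! ### Coordinates and monotone dynamics on a star -/

/-- Coordinates on a star: `u j` measures the position along the edge `I j` (and vanishes off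
that edge), and `e j` is the parametrization of the edge. -/
structure StarChart {X : Type*} [TopologicalSpace X] {k : ℕ} (b : X) (I : Fin k → Set X) where
  u : Fin k → X → unitInterval
  e : Fin k → unitInterval → X
  continuous_u : ∀ j, Continuous (u j)
  continuous_e : ∀ j, Continuous (e j)
  e_zero : ∀ j, e j 0 = b
  e_mem : ∀ j s, e j s ∈ I j
  u_e : ∀ j s, u j (e j s) = s
  e_u : ∀ j, ∀ x ∈ I j, e j (u j x) = x
  u_of_notMem : ∀ j, ∀ x ∉ I j, u j x = 0
  exists_mem : ∀ x, ∃ j, x ∈ I j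
  eq_center : ∀ i j, i ≠ j → ∀ x ∈ I i, x ∈ I j → x = b

theorem IsStar.nonempty_chart {X : Type*} [TopologicalSpace X] [T2Space X] {k : ℕ} {b : X}
    {I : Fin k → Set X} (hX : IsStar b I) : Nonempty (StarChart b I) := by
  classical
  choose h hb using hX.arc
  have hcl : ∀ j, IsClosed (I j) := fun j => by
    have : I j = range (fun s => (h j s : X)) := by
      ext x
      constructor
      · intro hx
        exact ⟨(h j).symm ⟨x, hx⟩, by simp⟩
      · rintro ⟨s, rfl⟩
        exact (h j s).2
    rw [this]
    exact (isCompact_range (continuous_subtype_val.comp (h j).continuous)).isClosed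
  have hcen : ∀ i j, i ≠ j → ∀ x ∈ I i, x ∈ I j → x = b := fun i j hij x hi hj => by
    have : x ∈ I i ∩ I j := ⟨hi, hj⟩
    rw [hX.inter i j hij] at this
    exact this
  have hbm : ∀ j, b ∈ I j := fun j => hb j ▸ (h j 0).2
  have hsb : ∀ j, (h j).symm ⟨b, hbm j⟩ = 0 := fun j => by
    rw [Homeomorph.symm_apply_eq]
    exact Subtype.ext (hb j).symm
  refine ⟨⟨fun j x => if hx : x ∈ I j then (h j).symm ⟨x, hx⟩ else 0, fun j s => h j s, ?_,
    fun j => continuous_subtype_val.comp (h j).continuous, hb, fun j s => (h j s).2, ?_, ?_, ?_,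
    ?_, hcen⟩⟩
  · intro j
    refine (locallyFinite_of_finite I).continuous hX.cover hcl fun i => ?_
    by_cases hij : i = j
    · subst hij
      rw [continuousOn_iff_continuous_domRestrict]
      convert (h i).symm.continuous using 1
      ext x
      simp
    · refine (continuousOn_const (c := (0 : unitInterval))).congr fun x hx => ?_
      by_cases hxj : x ∈ I j
      · have := hcen i j hij x hx hxj
        subst this
        simp [hxj, hsb]
      · simp [hxj]
  · intro j s
    simp
  · intro j x hx
    simp [hx]
  · intro j x hx
    simp [hx]
  · intro x
    exact mem_iUnion.1 (hX.cover ▸ mem_univ x)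

namespace StarChart

variable {X : Type*} [TopologicalSpace X] {k : ℕ} {b : X} {I : Fin k → Set X} (c : StarChart b I)
include c

theorem center_mem (j : Fin k) : b ∈ I j := c.e_zero j ▸ c.e_mem j 0

theorem u_center (j : Fin k) : c.u j b = 0 := by
  simpa only [c.e_zero] using c.u_e j 0

theorem mem_of_u_ne_zero {j : Fin k} {x : X} (h : c.u j x ≠ 0) : x ∈ I j := by
  by_contra hx
  exact h (c.u_of_notMem j x hx)

theorem u_eq_zero_iff {j : Fin k} {x : X} (hx : x ∈ I j) : c.u j x = 0 ↔ x = b := by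
  constructor
  · intro h
    rw [← c.e_u j x hx, h, c.e_zero]
  · intro h
    rw [h, c.u_center]

theorem u_injOn (j : Fin k) : InjOn (c.u j) (I j) := fun x hx y hy h => by
  rw [← c.e_u j x hx, h, c.e_u j y hy]

theorem u_eq_zero_of_mem {i j : Fin k} (hij : i ≠ j) {x : X} (hx : x ∈ I i) : c.u j x = 0 := by
  by_cases hj : x ∈ I j
  · rw [c.eq_center i j hij x hx hj, c.u_center]
  · exact c.u_of_notMem j x hj

theorem isClosed_edge [T2Space X] (j : Fin k) : IsClosed (I j) := by
  have : I j = range (c.e j) := by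
    ext x
    exact ⟨fun hx => ⟨_, c.e_u j x hx⟩, by rintro ⟨s, rfl⟩; exact c.e_mem j s⟩
  rw [this]
  exact (isCompact_range (c.continuous_e j)).isClosed

/-- A connected set avoiding the centre lies in one edge. -/
theorem subset_edge [T2Space X] {S : Set X} (hS : IsPreconnected S) (hb : b ∉ S) {j : Fin k}
    {x : X} (hx : x ∈ S) (hxj : x ∈ I j) : S ⊆ I j := by
  have hne : ∀ y ∈ S, y ∈ I j → c.u j y ≠ 0 := fun y hy hyj h =>
    hb (((c.u_eq_zero_iff hyj).1 h) ▸ hy)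
  have hopen : IsOpen {y | c.u j y ≠ 0} := (isOpen_ne (x := (0 : unitInterval))).preimage
    (c.continuous_u j)
  -- Away from `b`, the edge and its complement are both open, so they disconnect `S` unless one of
  -- them misses it.
  have := hS.subset_left_of_subset_union (u := {y | c.u j y ≠ 0}) (v := (I j)ᶜ) hopen
    (c.isClosed_edge j).isOpen_compl
    (Set.disjoint_left.2 fun y hy hy' => hy' (c.mem_of_u_ne_zero hy))
    (fun y hy => by
      by_cases hyj : y ∈ I j
      · exact Or.inl (hne y hy hyj)
      · exact Or.inr hyj) ⟨x, hx, hne x hx hxj⟩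
  exact fun y hy => c.mem_of_u_ne_zero (this hy)

/-- A connected set which contains the centre or lies in an edge contains all points of that edge
between two of its levels. -/
theorem mem_of_between {L : Set X} (hL : IsPreconnected L) {j : Fin k} (hb : b ∈ L ∨ L ⊆ I j)
    {y y' w : X} (hy : y ∈ L) (hy' : y' ∈ L) (hw : w ∈ I j) (h1 : c.u j y' ≤ c.u j w)
    (h2 : c.u j w ≤ c.u j y) : w ∈ L := by
  have hpre : IsPreconnected (c.u j '' L) := hL.image _ (c.continuous_u j).continuousOn
  obtain ⟨z, hz, hzw⟩ := hpre.ordConnected.out (mem_image_of_mem _ hy') (mem_image_of_mem _ hy)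
    ⟨h1, h2⟩
  by_cases hzj : z ∈ I j
  · rwa [← c.u_injOn j hzj hw hzw]
  · rw [c.u_of_notMem j z hzj] at hzw
    rw [(c.u_eq_zero_iff hw).1 hzw.symm]
    exact hb.resolve_right fun h => hzj (h hz)

/-- A homeomorphism fixing the centre and preserving an edge acts monotonically on it. -/
theorem u_lt_u_map (F : X ≃ₜ X) (hb : F b = b) {j : Fin k} (hF : ∀ x, F x ∈ I j ↔ x ∈ I j)
    {x y : X} (hxy : c.u j x < c.u j y) : c.u j (F x) < c.u j (F y) := by
  -- In the coordinate of the edge, `F` is an injective continuous map of the unit interval sending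
  -- 0 to 0, hence increasing.
  have hmono : StrictMono fun s => c.u j (F (c.e j s)) := by
    refine Continuous.strictMono_of_inj_boundedOrder
      ((c.continuous_u j).comp (F.continuous.comp (c.continuous_e j))) ?_ ?_
    · have : c.e j ⊥ = b := c.e_zero j
      simp only [this, hb, c.u_center]
      exact bot_le
    · intro s t hst
      have := F.injective (c.u_injOn j ((hF _).2 (c.e_mem j s)) ((hF _).2 (c.e_mem j t)) hst)
      rw [← c.u_e j s, this, c.u_e]
  have key : ∀ z, c.u j (F z) = c.u j (F (c.e j (c.u j z))) := fun z => by
    by_cases hz : z ∈ I j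
    · rw [c.e_u j z hz]
    · rw [c.u_of_notMem j z hz, c.e_zero, hb, c.u_center,
        c.u_of_notMem j _ (fun h => hz ((hF z).1 h))]
  rw [key x, key y]
  exact hmono hxy

theorem u_le_u_map (F : X ≃ₜ X) (hb : F b = b) {j : Fin k} (hF : ∀ x, F x ∈ I j ↔ x ∈ I j)
    {x y : X} (hxy : c.u j x ≤ c.u j y) : c.u j (F x) ≤ c.u j (F y) := by
  by_contra! h
  have h1 := c.u_lt_u_map F⁻¹ (by simp [Homeomorph.symm_apply_eq, hb]) (j := j)
    (fun x => by simp [← hF (F.symm x)]) h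
  simp at h1
  exact absurd h1 hxy.not_gt

end StarChart

section Powers

variable {X : Type*} [TopologicalSpace X] {F : X ≃ₜ X} {b : X} {S : Set X}

theorem zpow_apply_of_fixed (hb : F b = b) (m : ℤ) : (F ^ m) b = b := by
  induction m using Int.induction_on with
  | zero => rfl
  | succ n ih => rw [zpow_add_one, Homeomorph.mul_apply, hb, ih]
  | pred n ih => rw [zpow_sub_one, Homeomorph.mul_apply, Homeomorph.inv_apply,
      (Homeomorph.symm_apply_eq F).2 hb.symm, ih]

theorem zpow_mem_iff (hF : ∀ x, F x ∈ S ↔ x ∈ S) (m : ℤ) (x : X) : (F ^ m) x ∈ S ↔ x ∈ S := by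
  induction m using Int.induction_on generalizing x with
  | zero => rfl
  | succ n ih => rw [zpow_add_one, Homeomorph.mul_apply, ih, hF]
  | pred n ih => rw [zpow_sub_one, Homeomorph.mul_apply, Homeomorph.inv_apply, ih,
      ← hF (F.symm x), F.apply_symm_apply]

end Powers

namespace StarChart

variable {X : Type*} [TopologicalSpace X] {k : ℕ} {b : X} {I : Fin k → Set X} (c : StarChart b I)
include c

theorem u_ne_u_map {F : X ≃ₜ X} {j : Fin k} (hF : ∀ x, F x ∈ I j ↔ x ∈ I j) {x : X}
    (hx : x ∈ I j) (hne : F x ≠ x) : c.u j (F x) ≠ c.u j x :=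
  fun h => hne (c.u_injOn j ((hF x).2 hx) hx h)

/-- Levels along the orbit of a point that moves away from the centre are strictly increasing. -/
theorem strictMono_level {F : X ≃ₜ X} (hb : F b = b) {j : Fin k} (hF : ∀ x, F x ∈ I j ↔ x ∈ I j)
    {x : X} (h : c.u j x < c.u j (F x)) : StrictMono fun m : ℤ => c.u j ((F ^ m) x) := by
  refine strictMono_int_of_lt_succ fun m => ?_
  have := c.u_lt_u_map (F ^ m) (zpow_apply_of_fixed hb m) (fun x => zpow_mem_iff hF m x) h
  rwa [← Homeomorph.mul_apply, ← zpow_add_one] at this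

theorem strictAnti_level {F : X ≃ₜ X} (hb : F b = b) {j : Fin k} (hF : ∀ x, F x ∈ I j ↔ x ∈ I j)
    {x : X} (h : c.u j (F x) < c.u j x) : StrictAnti fun m : ℤ => c.u j ((F ^ m) x) := by
  refine strictAnti_int_of_succ_lt fun m => ?_
  have := c.u_lt_u_map (F ^ m) (zpow_apply_of_fixed hb m) (fun x => zpow_mem_iff hF m x) h
  rwa [← Homeomorph.mul_apply, ← zpow_add_one] at this

/-- The open interval between a moved point and its image consists of points whose neighbourhood
never returns. -/
theorem exists_open_of_moved {F : X ≃ₜ X} (hb : F b = b) {j : Fin k}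
    (hF : ∀ x, F x ∈ I j ↔ x ∈ I j) {x : X} (hx : x ∈ I j) (hne : F x ≠ x) :
    ∃ U : Set X, IsOpen U ∧ U.Nonempty ∧ U ⊆ I j ∧ b ∉ U ∧
      (∀ n : ℕ, 1 ≤ n → ∀ y ∈ U, (F ^ n) y ∉ U) ∧
      ∀ y ∈ U, (c.u j x < c.u j y ∧ c.u j y < c.u j (F x)) ∨
        (c.u j (F x) < c.u j y ∧ c.u j y < c.u j x) := by
  have hpow : ∀ n : ℕ, ∀ y z, c.u j y < c.u j z → c.u j ((F ^ n) y) < c.u j ((F ^ n) z) := by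
    intro n y z hyz
    have := c.u_lt_u_map (F ^ (n : ℤ)) (zpow_apply_of_fixed hb n) (fun x => zpow_mem_iff hF n x) hyz
    simpa only [zpow_natCast] using this
  rcases lt_or_gt_of_ne (c.u_ne_u_map hF hx hne) with h | h
  · refine ⟨c.u j ⁻¹' Ioo (c.u j (F x)) (c.u j x), isOpen_Ioo.preimage (c.continuous_u j), ?_, ?_,
      ?_, ?_, fun y hy => Or.inr hy⟩
    · obtain ⟨s, hs⟩ := exists_between h
      exact ⟨c.e j s, by simpa [c.u_e] using hs⟩
    · intro y hy
      exact c.mem_of_u_ne_zero (lt_of_le_of_lt bot_le hy.1).ne'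
    · intro h0
      have := h0.1
      rw [c.u_center] at this
      exact absurd this (not_lt_bot)
    · intro n hn y hy hy'
      have h1 := hpow n y x hy.2
      have h2 : c.u j ((F ^ n) x) ≤ c.u j (F x) := by
        -- From the first step on, the image of the interval lies beyond `F x`, which is an end of
        -- the interval.
        have := (c.strictAnti_level hb hF h).antitone (show (1 : ℤ) ≤ n by exact_mod_cast hn)
        simpa using this
      exact absurd (h1.trans_le h2) hy'.1.not_gt
  · refine ⟨c.u j ⁻¹' Ioo (c.u j x) (c.u j (F x)), isOpen_Ioo.preimage (c.continuous_u j), ?_, ?_,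
      ?_, ?_, fun y hy => Or.inl hy⟩
    · obtain ⟨s, hs⟩ := exists_between h
      exact ⟨c.e j s, by simpa [c.u_e] using hs⟩
    · intro y hy
      exact c.mem_of_u_ne_zero (lt_of_le_of_lt bot_le hy.1).ne'
    · intro h0
      have := h0.1
      rw [c.u_center] at this
      exact absurd this (not_lt_bot)
    · intro n hn y hy hy'
      have h1 := hpow n x y hy.1
      have h2 : c.u j (F x) ≤ c.u j ((F ^ n) x) := by
        have := (c.strictMono_level hb hF h).monotone (show (1 : ℤ) ≤ n by exact_mod_cast hn)
        simpa using this
      exact absurd (h2.trans_lt h1) hy'.2.not_gt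

end StarChart

/-! ### The upper bound -/

namespace StarChart

variable {X : Type*} [MetricSpace X] {k : ℕ} {b : X} {I : Fin k → Set X} (c : StarChart b I)
include c

/-- Counting separated subcontinua of a star by monotone codes of points: a subcontinuum through
the centre is coded by the largest codes on all edges, any other one by the smallest and the
largest code on its edge. -/
theorem sepCard_inducedMap_le (f : X → X) (hf : Continuous f) {n : ℕ} {r ε : ℝ} (hr : 0 ≤ r)
    (hrε : r < ε) (κ : Fin k → X → ℕ) (B : Fin k → ℕ) (hB : ∀ j x, κ j x < B j)
    (hmono : ∀ j x y, c.u j x ≤ c.u j y → κ j x ≤ κ j y)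
    (hclose : ∀ j, ∀ x ∈ I j, ∀ y ∈ I j, κ j x = κ j y →
      ∀ i < n, dist (f^[i] x) (f^[i] y) ≤ r) :
    sepCard (inducedMap f hf) n ε ≤ ((∏ j, B j + ∑ j, B j ^ 2 : ℕ) : ℕ∞) := by
  classical
  have hT : ∀ (K : Subcontinua X) j, ∃ x ∈ (K.1 : Set X), ∀ y ∈ (K.1 : Set X), κ j y ≤ κ j x := by
    intro K j
    have hbdd : BddAbove (κ j '' (K.1 : Set X)) :=
      ⟨B j, by rintro _ ⟨x, -, rfl⟩; exact (hB j x).le⟩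
    obtain ⟨x, hx, h⟩ := Nat.sSup_mem (K.1.nonempty.image (κ j)) hbdd
    exact ⟨x, hx, fun y hy => h ▸ le_csSup hbdd (mem_image_of_mem _ hy)⟩
  have hA : ∀ (K : Subcontinua X) j, ∃ x ∈ (K.1 : Set X), ∀ y ∈ (K.1 : Set X), κ j x ≤ κ j y := by
    intro K j
    obtain ⟨x, hx, h⟩ := Nat.sInf_mem (K.1.nonempty.image (κ j))
    exact ⟨x, hx, fun y hy => h ▸ Nat.sInf_le (mem_image_of_mem _ hy)⟩
  choose top htop htop' using hT
  choose bot hbot hbot' using hA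
  have hrefl : ∀ x : X, ∀ i < n, dist (f^[i] x) (f^[i] x) ≤ r := fun x i _ => by simpa using hr
  have hcen : ∀ K L : Subcontinua X, b ∈ (K.1 : Set X) → b ∈ (L.1 : Set X) →
      (∀ j, κ j (top K j) = κ j (top L j)) → ∀ x ∈ (K.1 : Set X), ∃ y ∈ (L.1 : Set X),
        ∀ i < n, dist (f^[i] x) (f^[i] y) ≤ r := by
    intro K L hK hL h x hx
    obtain ⟨j, hj⟩ := c.exists_mem x
    rcases le_or_gt (c.u j x) (c.u j (top L j)) with h1 | h1
    · exact ⟨x, c.mem_of_between L.2.isPreconnected (Or.inl hL) (htop L j) hL hj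
        (by rw [c.u_center]; exact bot_le) h1, hrefl x⟩
    -- Here `x` lies above `top L j`, so its code is squeezed between the equal top codes of `L` and
    -- `K`.
    · have heq : κ j x = κ j (top L j) :=
        le_antisymm (h j ▸ htop' K j x hx) (hmono j _ _ h1.le)
      by_cases hm : top L j ∈ I j
      · exact ⟨top L j, htop L j, hclose j x hj _ hm heq⟩
      -- A maximizer off the edge has level 0, hence the code of `b`, which can replace it.
      · refine ⟨b, hL, hclose j x hj b (c.center_mem j) (heq.trans ?_)⟩
        have : c.u j (top L j) = c.u j b := by rw [c.u_of_notMem j _ hm, c.u_center]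
        exact le_antisymm (hmono j _ _ this.le) (hmono j _ _ this.ge)
  have hedge : ∀ j, ∀ K L : Subcontinua X, (K.1 : Set X) ⊆ I j → (L.1 : Set X) ⊆ I j →
      κ j (top K j) = κ j (top L j) → κ j (bot K j) = κ j (bot L j) →
      ∀ x ∈ (K.1 : Set X), ∃ y ∈ (L.1 : Set X), ∀ i < n, dist (f^[i] x) (f^[i] y) ≤ r := by
    intro j K L hK hL h h' x hx
    rcases le_or_gt (c.u j x) (c.u j (top L j)) with h1 | h1
    · rcases le_or_gt (c.u j (bot L j)) (c.u j x) with h2 | h2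
      · exact ⟨x, c.mem_of_between L.2.isPreconnected (Or.inr hL) (htop L j) (hbot L j) (hK hx)
          h2 h1, hrefl x⟩
      · exact ⟨bot L j, hbot L j, hclose j x (hK hx) _ (hL (hbot L j))
          (le_antisymm (hmono j _ _ h2.le) (h' ▸ hbot' K j x hx))⟩
    · exact ⟨top L j, htop L j, hclose j x (hK hx) _ (hL (htop L j))
        (le_antisymm (h ▸ htop' K j x hx) (hmono j _ _ h1.le))⟩
  refine iSup_le fun ⟨E, hE⟩ => ?_
  have hsep : ∀ K ∈ E, ∀ L ∈ E, dynDist (inducedMap f hf) n K L ≤ r → K = L := by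
    intro K hK L hL h
    by_contra hne
    exact absurd (hE K hK L hL hne) (not_le.2 (h.trans_lt hrε))
  have hcover : E ⊆ E.filter (fun K => b ∈ (K.1 : Set X)) ∪
      Finset.univ.biUnion fun j => E.filter (fun K => (K.1 : Set X) ⊆ I j) := by
    intro K hK
    by_cases hb : b ∈ (K.1 : Set X)
    · exact Finset.mem_union_left _ (Finset.mem_filter.2 ⟨hK, hb⟩)
    · obtain ⟨x, hx⟩ := K.1.nonempty
      obtain ⟨j, hj⟩ := c.exists_mem x
      exact Finset.mem_union_right _ (Finset.mem_biUnion.2 ⟨j, Finset.mem_univ _,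
        Finset.mem_filter.2 ⟨hK, c.subset_edge K.2.isPreconnected hb hx hj⟩⟩)
  have hcard1 : (E.filter (fun K => b ∈ (K.1 : Set X))).card ≤ ∏ j, B j := by
    have : (Fintype.piFinset fun j => Finset.range (B j)).card = ∏ j, B j := by
      simp [Fintype.card_piFinset]
    rw [← this]
    refine Finset.card_le_card_of_injOn (fun K j => κ j (top K j)) ?_ ?_
    · intro K _
      simpa [Fintype.mem_piFinset] using fun j => hB j _
    · intro K hK L hL h
      simp only [Finset.coe_filter, mem_ofPred_eq] at hK hL
      exact hsep K hK.1 L hL.1 (dynDist_inducedMap_le f hf hr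
        (hcen K L hK.2 hL.2 fun j => congrFun h j)
        (hcen L K hL.2 hK.2 fun j => (congrFun h j).symm))
  have hcard2 : ∀ j, (E.filter (fun K => (K.1 : Set X) ⊆ I j)).card ≤ B j ^ 2 := by
    intro j
    have : (Finset.range (B j) ×ˢ Finset.range (B j)).card = B j ^ 2 := by
      simp [sq]
    rw [← this]
    refine Finset.card_le_card_of_injOn (fun K => (κ j (top K j), κ j (bot K j))) ?_ ?_
    · intro K _
      simp [hB]
    · intro K hK L hL h
      simp only [Finset.coe_filter, mem_ofPred_eq] at hK hL
      simp only [Prod.mk.injEq] at h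
      exact hsep K hK.1 L hL.1 (dynDist_inducedMap_le f hf hr
        (hedge j K L hK.2 hL.2 h.1 h.2) (hedge j L K hL.2 hK.2 h.1.symm h.2.symm))
  have : E.card ≤ ∏ j, B j + ∑ j, B j ^ 2 :=
    (Finset.card_le_card hcover).trans <| (Finset.card_union_le _ _).trans <|
      add_le_add hcard1 <| Finset.card_biUnion_le.trans <| Finset.sum_le_sum fun j _ => hcard2 j
  exact_mod_cast this

end StarChart

/-- Points with equal integer parts of all their scaled levels have close levels. -/
theorem abs_sub_lt_of_floor_eq {M : ℕ} (hM : 0 < M) {s t : ℝ} (hs : 0 ≤ s) (ht : 0 ≤ t)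
    (h : ⌊M * s⌋₊ = ⌊M * t⌋₊) : |s - t| < 1 / M := by
  have hM' : (0 : ℝ) < M := by exact_mod_cast hM
  have h1 := Nat.floor_le (mul_nonneg hM'.le hs)
  have h2 := Nat.lt_floor_add_one (M * s)
  have h3 := Nat.floor_le (mul_nonneg hM'.le ht)
  have h4 := Nat.lt_floor_add_one (M * t)
  rw [h] at h1 h2
  have h5 : |s - t| * M = |M * s - M * t| := by rw [← mul_sub, abs_mul, abs_of_pos hM', mul_comm]
  rw [lt_div_iff₀ hM', h5, abs_lt]
  constructor <;> linarith

namespace StarChart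

variable {X : Type*} [MetricSpace X] [CompactSpace X] {k : ℕ} {b : X} {I : Fin k → Set X}
  (c : StarChart b I)
include c

/-- Points on an edge with close levels at all times have close orbits. -/
theorem exists_close_of_levels (f : X ≃ₜ X) {N : ℕ} (hN : 1 ≤ N)
    (hI : ∀ j x, (f ^ N) x ∈ I j ↔ x ∈ I j) {r : ℝ} (hr : 0 < r) :
    ∃ η : ℝ, 0 < η ∧ ∀ n j, ∀ x ∈ I j, ∀ y ∈ I j,
      (∀ q < n, |(c.u j (((f ^ N) ^ q) x) : ℝ) - c.u j (((f ^ N) ^ q) y)| < η) →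
      ∀ i < n, dist (f^[i] x) (f^[i] y) ≤ r := by
  have h1 : ∀ᶠ p in uniformity X, ∀ i ∈ Finset.range N, dist (f^[i] p.1) (f^[i] p.2) < r := by
    refine (Filter.eventually_all_finset _).2 fun i _ => ?_
    have hu : UniformContinuous f^[i] :=
      CompactSpace.uniformContinuous_of_continuous (f.continuous.iterate i)
    exact hu (Metric.dist_mem_uniformity hr)
  obtain ⟨δ, hδ, h1⟩ := Metric.mem_uniformity_dist.1 h1
  have h2 : ∀ᶠ p in uniformity unitInterval, ∀ j, dist (c.e j p.1) (c.e j p.2) < δ := by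
    refine Filter.eventually_all.2 fun j => ?_
    have hu : UniformContinuous (c.e j) :=
      CompactSpace.uniformContinuous_of_continuous (c.continuous_e j)
    exact hu (Metric.dist_mem_uniformity hδ)
  obtain ⟨η, hη, h2⟩ := Metric.mem_uniformity_dist.1 h2
  refine ⟨η, hη, fun n j x hx y hy h i hi => ?_⟩
  have hmem : ∀ q z, z ∈ I j → ((f ^ N) ^ q) z ∈ I j := fun q z hz => by
    have := zpow_mem_iff (hI j) (q : ℤ) z
    rw [zpow_natCast] at this
    exact this.2 hz
  -- Writing `i = N * (i / N) + i % N` leaves only the iterates below `N` to control, so `η` does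
  -- not depend on `n`.
  have hq : i / N < n := (Nat.div_le_self i N).trans_lt hi
  have hdist := h2 (a := c.u j (((f ^ N) ^ (i / N)) x)) (b := c.u j (((f ^ N) ^ (i / N)) y))
    (by rw [Subtype.dist_eq, Real.dist_eq]; exact h _ hq) j
  simp only [c.e_u j _ (hmem _ x hx), c.e_u j _ (hmem _ y hy)] at hdist
  have hit : ∀ z, f^[i] z = f^[i % N] (((f ^ N) ^ (i / N)) z) := fun z => by
    rw [← pow_mul, Homeomorph.coe_pow_eq_iterate, ← Function.iterate_add_apply, Nat.mod_add_div]
  rw [hit x, hit y]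
  exact (h1 hdist _ (Finset.mem_range.2 (Nat.mod_lt _ hN))).le

/-- The code of a point on a moved edge is the sum over `q < n` of the integer parts of `M` times
its level at time `q`. Each term is monotone along the edge, so equal sums force equal terms: one
integer of size at most `n * M` records the whole itinerary. On a pointwise fixed edge a single term
suffices. -/
theorem polEntropy_inducedMap_le (f : X ≃ₜ X) {N : ℕ} (hN : 1 ≤ N) (hb : (f ^ N) b = b)
    (hI : ∀ j x, (f ^ N) x ∈ I j ↔ x ∈ I j) {l D : ℕ}
    (hl : {j : Fin k | ∃ x ∈ I j, (f ^ N) x ≠ x}.ncard = l) (hD : l ≤ D)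
    (hD2 : 1 ≤ l → 2 ≤ D) : polEntropy (inducedMap f f.continuous) ≤ (D : EReal) := by
  classical
  refine polEntropy_le_of_sepCard_le fun ε hε => ?_
  obtain ⟨η, hη, hclose⟩ := c.exists_close_of_levels f hN hI (half_pos hε)
  obtain ⟨m, hm⟩ := exists_nat_one_div_lt hη
  set M : ℕ := m + 1 with hMdef
  have hM : 0 < M := Nat.succ_pos m
  have hMη : 1 / (M : ℝ) < η := by rw [hMdef]; exact_mod_cast hm
  set F := f ^ N with hF
  set P : Fin k → Prop := fun j => ∃ x ∈ I j, F x ≠ x with hP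
  set v : Fin k → X → ℕ := fun j x => ⌊(M : ℝ) * c.u j x⌋₊ with hv
  have hvle : ∀ j x, v j x ≤ M := fun j x => by
    refine Nat.floor_le_of_le ?_
    have h1 : (c.u j x : ℝ) ≤ 1 := (c.u j x).2.2
    have h2 : (0 : ℝ) ≤ M := Nat.cast_nonneg M
    nlinarith
  have hvmono : ∀ j x y, c.u j x ≤ c.u j y → v j x ≤ v j y := fun j x y h =>
    Nat.floor_mono (mul_le_mul_of_nonneg_left h (Nat.cast_nonneg M))
  have hpow : ∀ (q : ℕ) j x y, c.u j x ≤ c.u j y → c.u j ((F ^ q) x) ≤ c.u j ((F ^ q) y) := by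
    intro q j x y h
    have := c.u_le_u_map (F ^ (q : ℤ)) (zpow_apply_of_fixed hb q)
      (fun x => zpow_mem_iff (hI j) q x) h
    simpa only [zpow_natCast] using this
  set w : Fin k → ℕ := fun j => if P j then 1 else 0 with hw
  have hwl : ∑ j, w j = l := by
    rw [← hl, hw, Finset.sum_boole, Nat.cast_id, ← Set.ncard_coe_finset]
    simp [hP]
  refine ⟨(M + 1) ^ k + k * (M + 1) ^ 2, fun n hn => ?_⟩
  set κ : Fin k → X → ℕ := fun j x =>
    if P j then ∑ q ∈ Finset.range n, v j ((F ^ q) x) else v j x with hκ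
  set B : Fin k → ℕ := fun j => (M + 1) * n ^ w j with hBdef
  have hBlt : ∀ j x, κ j x < B j := by
    intro j x
    by_cases hj : P j
    · simp only [hκ, hBdef, hw, hj, if_true, pow_one]
      have : ∑ q ∈ Finset.range n, v j ((F ^ q) x) ≤ n * M := by
        simpa using Finset.sum_le_card_nsmul (Finset.range n) _ M fun q _ => hvle j ((F ^ q) x)
      nlinarith
    · simp only [hκ, hBdef, hw, hj, if_false, pow_zero, mul_one]
      exact Nat.lt_succ_of_le (hvle j x)
  have hκmono : ∀ j x y, c.u j x ≤ c.u j y → κ j x ≤ κ j y := by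
    intro j x y h
    by_cases hj : P j
    · simp only [hκ, hj, if_true]
      exact Finset.sum_le_sum fun q _ => hvmono j _ _ (hpow q j x y h)
    · simp only [hκ, hj, if_false]
      exact hvmono j x y h
  have hlev : ∀ j, ∀ x ∈ I j, ∀ y ∈ I j, κ j x = κ j y → c.u j x ≤ c.u j y → ∀ q < n,
      v j ((F ^ q) x) = v j ((F ^ q) y) := by
    intro j x hx y hy h hxy q hq
    by_cases hj : P j
    · simp only [hκ, hj, if_true] at h
      exact (Finset.sum_eq_sum_iff_of_le fun q _ => hvmono j _ _ (hpow q j x y hxy)).1 h q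
        (Finset.mem_range.2 hq)
    · simp only [hκ, hj, if_false] at h
      have hid : ∀ z ∈ I j, (F ^ q) z = z := fun z hz => by
        have : F z = z := by
          by_contra hne
          exact hj ⟨z, hz, hne⟩
        rw [Homeomorph.coe_pow_eq_iterate]
        exact Function.iterate_fixed this q
      rw [hid x hx, hid y hy, h]
  have hκclose : ∀ j, ∀ x ∈ I j, ∀ y ∈ I j, κ j x = κ j y →
      ∀ i < n, dist (f^[i] x) (f^[i] y) ≤ ε / 2 := by
    intro j x hx y hy h
    refine hclose n j x hx y hy fun q hq => ?_
    have hfl : v j ((F ^ q) x) = v j ((F ^ q) y) := by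
      rcases le_total (c.u j x) (c.u j y) with hxy | hxy
      · exact hlev j x hx y hy h hxy q hq
      · exact (hlev j y hy x hx h.symm hxy q hq).symm
    exact (abs_sub_lt_of_floor_eq hM (c.u j _).2.1 (c.u j _).2.1 hfl).trans hMη
  refine (c.sepCard_inducedMap_le f f.continuous (half_pos hε).le (half_lt_self hε) κ B hBlt hκmono
    hκclose).trans ?_
  have hprod : ∏ j, B j ≤ (M + 1) ^ k * n ^ D := by
    simp only [hBdef, Finset.prod_mul_distrib, Finset.prod_const, Finset.card_univ,
      Fintype.card_fin, Finset.prod_pow_eq_pow_sum, hwl]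
    exact Nat.mul_le_mul_left _ (Nat.pow_le_pow_right hn hD)
  -- The squares count arcs inside one edge. They grow like `n ^ 2` only on a moved edge, whose
  -- existence forces `1 ≤ l`.
  have hw2 : ∀ j, w j * 2 ≤ D := fun j => by
    by_cases hj : P j
    · have h1 : w j ≤ ∑ j, w j := Finset.single_le_sum (fun _ _ => Nat.zero_le _) (Finset.mem_univ j)
      have h2 : w j = 1 := by simp [hw, hj]
      have := hD2 (by omega)
      omega
    · simp [hw, hj]
  have hsum : ∑ j, B j ^ 2 ≤ k * (M + 1) ^ 2 * n ^ D := by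
    have : ∀ j ∈ Finset.univ, B j ^ 2 ≤ (M + 1) ^ 2 * n ^ D := fun j _ => by
      simp only [hBdef, mul_pow, ← pow_mul]
      exact Nat.mul_le_mul_left _ (Nat.pow_le_pow_right hn (hw2 j))
    simpa [mul_assoc] using Finset.sum_le_card_nsmul _ _ _ this
  rw [add_mul]
  exact_mod_cast add_le_add hprod hsum

end StarChart

/-! ### The lower bounds -/

/-- Subcontinua are far apart at a time at which their highest levels are. -/
theorem le_dist_of_top_levels {X : Type*} [MetricSpace X] {w : X → ℝ} {δ ε : ℝ}
    (hw : ∀ x y, dist x y < ε → |w x - w y| < δ) (f : X → X) (hf : Continuous f) {n : ℕ}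
    {K L : Subcontinua X} {x x' : X} (hx : x ∈ (K.1 : Set X)) (hx' : x' ∈ (L.1 : Set X))
    (hK : ∀ y ∈ (K.1 : Set X), w (f^[n] y) ≤ w (f^[n] x))
    (hL : ∀ y ∈ (L.1 : Set X), w (f^[n] y) ≤ w (f^[n] x'))
    (hδ : δ ≤ |w (f^[n] x) - w (f^[n] x')|) :
    ε ≤ dist ((inducedMap f hf)^[n] K) ((inducedMap f hf)^[n] L) := by
  by_contra! h
  -- The point of `L` near the top of `K` is below the top of `L`, and symmetrically, so the two top
  -- levels would differ by less than `δ`.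
  obtain ⟨y, hy, hxy⟩ := exists_dist_lt_of_dist_iterate_inducedMap_lt f hf h hx
  rw [dist_comm] at h
  obtain ⟨y', hy', hxy'⟩ := exists_dist_lt_of_dist_iterate_inducedMap_lt f hf h hx'
  have h1 := abs_lt.1 (hw _ _ hxy)
  have h2 := abs_lt.1 (hw _ _ hxy')
  have h3 := hK _ hy'
  have h4 := hL _ hy
  refine absurd hδ (not_le.2 (abs_lt.2 ⟨?_, ?_⟩)) <;> linarith

/-- The nearest values to `s 0` are `s 1` and `s (-1)`. Gaps between arbitrary indices need not be
bounded below, since a bounded orbit accumulates; hence one index must be 0. -/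
theorem StrictMono.exists_gap {s : ℤ → ℝ} (hs : StrictMono s) :
    ∃ δ, 0 < δ ∧ ∀ m m' : ℤ, m ≠ m' → (m = 0 ∨ m' = 0) → δ ≤ |s m - s m'| := by
  have h1 := hs (show (0 : ℤ) < 1 by norm_num)
  have h2 := hs (show (-1 : ℤ) < 0 by norm_num)
  have key : ∀ m : ℤ, m ≠ 0 → min (s 1 - s 0) (s 0 - s (-1)) ≤ |s m - s 0| := by
    intro m hm
    rcases lt_or_gt_of_ne hm with h | h
    · have h3 := hs.monotone (show m ≤ -1 by omega)
      refine (min_le_right _ _).trans (le_trans ?_ (neg_le_abs _))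
      linarith
    · have h3 := hs.monotone (show 1 ≤ m by omega)
      refine (min_le_left _ _).trans (le_trans ?_ (le_abs_self _))
      linarith
  refine ⟨_, lt_min (sub_pos.2 h1) (sub_pos.2 h2), ?_⟩
  rintro m m' hmm (rfl | rfl)
  · rw [abs_sub_comm]
    exact key m' hmm.symm
  · exact key m hmm

theorem iterate_mul_eq_zpow {X : Type*} [TopologicalSpace X] (f : X ≃ₜ X) (N i : ℕ) (p : ℤ)
    (x : X) : f^[N * i] (((f ^ N) ^ p) x) = ((f ^ N) ^ ((i : ℤ) + p)) x := by
  rw [← Homeomorph.coe_pow_eq_iterate, pow_mul, ← zpow_natCast (f ^ N) i, zpow_add]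
  rfl

namespace StarChart

variable {X : Type*} [MetricSpace X] {k : ℕ} {b : X} {I : Fin k → Set X}
  (c : StarChart b I)
include c

theorem exists_gap {F : X ≃ₜ X} (hb : F b = b) {j : Fin k} (hF : ∀ x, F x ∈ I j ↔ x ∈ I j)
    {x : X} (hx : x ∈ I j) (hne : F x ≠ x) :
    ∃ δ : ℝ, 0 < δ ∧ ∀ m m' : ℤ, m ≠ m' → (m = 0 ∨ m' = 0) →
      δ ≤ |(c.u j ((F ^ m) x) : ℝ) - c.u j ((F ^ m') x)| := by
  rcases lt_or_gt_of_ne (c.u_ne_u_map hF hx hne) with h | h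
  · obtain ⟨δ, hδ, H⟩ := StrictMono.exists_gap (s := fun m => -(c.u j ((F ^ m) x) : ℝ))
      fun m m' hm => neg_lt_neg (c.strictAnti_level hb hF h hm)
    refine ⟨δ, hδ, fun m m' hm h0 => (H m m' hm h0).trans_eq ?_⟩
    rw [← abs_neg]
    congr 1
    ring
  · exact StrictMono.exists_gap (s := fun m => (c.u j ((F ^ m) x) : ℝ))
      fun m m' hm => c.strictMono_level hb hF h hm

/-- The part of a star below prescribed levels is a subcontinuum. -/
theorem isConnected_below (t : Fin k → unitInterval) : IsConnected {y | ∀ j, c.u j y ≤ t j} := by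
  have hb : b ∈ {y | ∀ j, c.u j y ≤ t j} := fun j => by rw [c.u_center]; exact bot_le
  refine ⟨⟨b, hb⟩, isPreconnected_of_forall b fun y hy => ?_⟩
  obtain ⟨j, hj⟩ := c.exists_mem y
  refine ⟨c.e j '' Icc 0 (c.u j y), ?_, ⟨0, ⟨le_rfl, bot_le⟩, c.e_zero j⟩,
    ⟨c.u j y, ⟨bot_le, le_rfl⟩, c.e_u j y hj⟩,
    isPreconnected_Icc.image _ (c.continuous_e j).continuousOn⟩
  rintro _ ⟨s, hs, rfl⟩ i
  by_cases hij : j = i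
  · subst hij
    rw [c.u_e]
    exact hs.2.trans (hy j)
  · rw [c.u_eq_zero_of_mem hij (c.e_mem j s)]
    exact bot_le

theorem isClosed_below (t : Fin k → unitInterval) : IsClosed {y | ∀ j, c.u j y ≤ t j} := by
  have : {y | ∀ j, c.u j y ≤ t j} = ⋂ j, c.u j ⁻¹' Iic (t j) := by ext; simp
  rw [this]
  exact isClosed_iInter fun j => isClosed_Iic.preimage (c.continuous_u j)

/-- The subarc of an edge between two of its points. -/
theorem exists_subarc {j : Fin k} {x y : X} (hx : x ∈ I j) (hy : y ∈ I j) :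
    ∃ K : Subcontinua X, x ∈ (K.1 : Set X) ∧ y ∈ (K.1 : Set X) ∧
      ∀ z ∈ (K.1 : Set X), z ∈ I j ∧ min (c.u j x) (c.u j y) ≤ c.u j z ∧
        c.u j z ≤ max (c.u j x) (c.u j y) := by
  have hconn : IsConnected (c.e j '' uIcc (c.u j x) (c.u j y)) :=
    ⟨nonempty_uIcc.image _, isPreconnected_uIcc.image _ (c.continuous_e j).continuousOn⟩
  refine ⟨⟨⟨⟨_, isCompact_uIcc.image (c.continuous_e j)⟩, hconn.1⟩, hconn⟩,
    ⟨_, left_mem_uIcc, c.e_u j x hx⟩, ⟨_, right_mem_uIcc, c.e_u j y hy⟩, ?_⟩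
  rintro _ ⟨s, hs, rfl⟩
  rw [c.u_e]
  exact ⟨c.e_mem j s, hs.1, hs.2⟩

variable [CompactSpace X]

theorem exists_uniform_u {δ : ℝ} (hδ : 0 < δ) :
    ∃ ε : ℝ, 0 < ε ∧ ∀ j x y, dist x y < ε → |(c.u j x : ℝ) - c.u j y| < δ := by
  have h2 : ∀ᶠ p in uniformity X, ∀ j, dist (c.u j p.1) (c.u j p.2) < δ := by
    refine Filter.eventually_all.2 fun j => ?_
    have hu : UniformContinuous (c.u j) :=
      CompactSpace.uniformContinuous_of_continuous (c.continuous_u j)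
    exact hu (Metric.dist_mem_uniformity hδ)
  obtain ⟨ε, hε, h2⟩ := Metric.mem_uniformity_dist.1 h2
  exact ⟨ε, hε, fun j x y h => h2 h j⟩

/-- On each moved edge the subcontinuum `K v` ends at `F ^ (-(v j))` of a chosen moved point `x j`.
If `v` and `v'` differ at `j`, then at time `N * v j` the tip of `K v` is at `x j` and that of `K
v'` is at another point of the same orbit, a definite distance away. -/
theorem card_moved_le_polEntropy (f : X ≃ₜ X) {N : ℕ} (hN : 1 ≤ N) (hb : (f ^ N) b = b)
    (hI : ∀ j x, (f ^ N) x ∈ I j ↔ x ∈ I j) {l : ℕ}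
    (hl : {j : Fin k | ∃ x ∈ I j, (f ^ N) x ≠ x}.ncard = l) :
    (l : EReal) ≤ polEntropy (inducedMap f f.continuous) := by
  classical
  set F := f ^ N with hF
  set P : Fin k → Prop := fun j => ∃ x ∈ I j, F x ≠ x with hP
  have hx : ∀ j, ∃ x, P j → x ∈ I j ∧ F x ≠ x := fun j => by
    by_cases hj : P j
    · obtain ⟨x, hx⟩ := hj
      exact ⟨x, fun _ => hx⟩
    · exact ⟨b, fun h => absurd h hj⟩
  choose x hx using hx
  have hδ : ∀ j, ∃ δ : ℝ, 0 < δ ∧ (P j → ∀ m m' : ℤ, m ≠ m' → (m = 0 ∨ m' = 0) →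
      δ ≤ |(c.u j ((F ^ m) (x j)) : ℝ) - c.u j ((F ^ m') (x j))|) := fun j => by
    by_cases hj : P j
    · obtain ⟨δ, hδ, h⟩ := c.exists_gap hb (hI j) (hx j hj).1 (hx j hj).2
      exact ⟨δ, hδ, fun _ => h⟩
    · exact ⟨1, one_pos, fun h => absurd h hj⟩
  choose δ hδ hgap using hδ
  obtain ⟨δ₀, hδ₀, hle⟩ : ∃ δ₀ : ℝ, 0 < δ₀ ∧ ∀ j, δ₀ ≤ δ j := by
    have h : ∀ᶠ d in 𝓝[>] (0 : ℝ), ∀ j, d ≤ δ j := Filter.eventually_all.2 fun j =>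
      nhdsWithin_le_nhds (Iic_mem_nhds (hδ j))
    obtain ⟨d, hd, hd0⟩ := (h.and self_mem_nhdsWithin).exists
    exact ⟨d, hd0, hd⟩
  obtain ⟨ε, hε, hu⟩ := c.exists_uniform_u hδ₀
  refine le_polEntropy_of_le_sepCard hN hε fun n hn => ?_
  set t : (Fin k → ℕ) → Fin k → unitInterval := fun v j =>
    if P j then c.u j ((F ^ (-(v j : ℤ))) (x j)) else 1 with ht
  have htP : ∀ v j, P j → t v j = c.u j ((F ^ (-(v j : ℤ))) (x j)) := fun v j hj => by
    simp only [ht, hj, if_true]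
  let K : (Fin k → ℕ) → Subcontinua X := fun v =>
    ⟨⟨⟨{y | ∀ j, c.u j y ≤ t v j}, (c.isClosed_below _).isCompact⟩, (c.isConnected_below _).1⟩,
      c.isConnected_below _⟩
  -- Only the index 0 is allowed on pointwise fixed edges, so two distinct vectors differ on a moved
  -- edge.
  set s : Finset (Fin k → ℕ) :=
    Fintype.piFinset fun j => Finset.range (if P j then n else 1) with hs
  have hcard : s.card = n ^ l := by
    have hwl : ∑ j, (if P j then 1 else 0) = l := by
      rw [← hl, Finset.sum_boole, Nat.cast_id, ← Set.ncard_coe_finset]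
      simp [hP]
    rw [← hwl, ← Finset.prod_pow_eq_pow_sum, hs, Fintype.card_piFinset]
    refine Finset.prod_congr rfl fun j _ => ?_
    by_cases hj : P j <;> simp [hj]
  rw [← hcard]
  refine card_le_sepCard s K hε fun v hv v' hv' hne => ?_
  obtain ⟨j, hj⟩ := Function.ne_iff.1 hne
  have hvj := Finset.mem_range.1 (Fintype.mem_piFinset.1 hv j)
  have hvj' := Finset.mem_range.1 (Fintype.mem_piFinset.1 hv' j)
  have hPj : P j := by
    by_contra hPj
    simp only [hPj, if_false] at hvj hvj'
    omega
  simp only [hPj, if_true] at hvj hvj'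
  have hmem : ∀ a : Fin k → ℕ, (F ^ (-(a j : ℤ))) (x j) ∈ ((K a).1 : Set X) := fun a i => by
    by_cases hij : j = i
    · subst hij
      exact (htP a j hPj).ge
    · rw [c.u_eq_zero_of_mem hij ((zpow_mem_iff (hI j) _ _).2 (hx j hPj).1)]
      exact bot_le
  have htop : ∀ a : Fin k → ℕ, ∀ y ∈ ((K a).1 : Set X), (c.u j (f^[N * v j] y) : ℝ) ≤
      c.u j (f^[N * v j] ((F ^ (-(a j : ℤ))) (x j))) := fun a y hy => by
    have h1 := c.u_le_u_map (F ^ ((v j : ℕ) : ℤ)) (zpow_apply_of_fixed hb _)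
      (fun x => zpow_mem_iff (hI j) _ x) ((hy j).trans (htP a j hPj).le)
    rw [zpow_natCast, hF, ← pow_mul, Homeomorph.coe_pow_eq_iterate] at h1
    exact h1
  refine ⟨N * v j, Nat.mul_lt_mul_of_pos_left hvj hN, ?_⟩
  refine le_dist_of_top_levels (w := fun y => (c.u j y : ℝ)) (δ := δ₀) (fun y z h => hu j y z h)
    f f.continuous (hmem v) (hmem v') (htop v) (htop v') ((hle j).trans ?_)
  simp only [hF, iterate_mul_eq_zpow]
  exact hgap j hPj _ _ (by omega) (by omega)

/-- The separated subcontinua are the arcs from `F ^ (-p) x` to `F ^ (-(n + q)) x` with `p, q < n`.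
The shift by `n` fixes the order of the two ends; each end is detected at the time it reaches `x`,
which is why `2 * n` steps of `F` are allowed. -/
theorem two_le_polEntropy (f : X ≃ₜ X) {N : ℕ} (hN : 1 ≤ N) (hb : (f ^ N) b = b)
    (hI : ∀ j x, (f ^ N) x ∈ I j ↔ x ∈ I j) {j : Fin k} {x : X} (hx : x ∈ I j)
    (hne : (f ^ N) x ≠ x) : (2 : EReal) ≤ polEntropy (inducedMap f f.continuous) := by
  set F := f ^ N with hF
  obtain ⟨δ, hδ, hgap⟩ := c.exists_gap hb (hI j) hx hne
  obtain ⟨ε, hε, hu⟩ := c.exists_uniform_u hδ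
  have hmem : ∀ m : ℤ, (F ^ m) x ∈ I j := fun m => (zpow_mem_iff (hI j) m x).2 hx
  choose K hK1 hK2 hK using fun p q : ℕ =>
    c.exists_subarc (hmem (-(p : ℤ))) (hmem (-(q : ℤ)))
  have hle : ∀ (i : ℕ) y z, c.u j y ≤ c.u j z →
      (c.u j (f^[N * i] y) : ℝ) ≤ c.u j (f^[N * i] z) := fun i y z h => by
    have h1 := c.u_le_u_map (F ^ (i : ℤ)) (zpow_apply_of_fixed hb _)
      (fun x => zpow_mem_iff (hI j) _ x) h
    rw [zpow_natCast, hF, ← pow_mul, Homeomorph.coe_pow_eq_iterate] at h1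
    exact h1
  -- `w` is the level up to sign, oriented so that `F` raises it along the orbit of `x`; the end
  -- with the smaller index is then the top.
  obtain ⟨w, hw, hwK⟩ : ∃ w : X → ℝ, (∀ y z, |w y - w z| = |(c.u j y : ℝ) - c.u j z|) ∧
      ∀ p q i : ℕ, p ≤ q → ∀ y ∈ ((K p q).1 : Set X),
        w (f^[N * i] y) ≤ w (f^[N * i] ((F ^ (-(p : ℤ))) x)) ∧
        w (f^[N * i] ((F ^ (-(q : ℤ))) x)) ≤ w (f^[N * i] y) := by
    rcases lt_or_gt_of_ne (c.u_ne_u_map (hI j) hx hne) with h | h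
    · refine ⟨fun y => -(c.u j y : ℝ), fun y z => ?_, fun p q i hpq y hy => ?_⟩
      · rw [← abs_neg]
        congr 1
        ring
      · have h1 := (c.strictAnti_level hb (hI j) h).antitone (show -(q : ℤ) ≤ -(p : ℤ) by omega)
        have h2 := (hK p q y hy).2
        rw [min_eq_left h1, max_eq_right h1] at h2
        exact ⟨neg_le_neg (hle i _ _ h2.1), neg_le_neg (hle i _ _ h2.2)⟩
    · refine ⟨fun y => (c.u j y : ℝ), fun y z => rfl, fun p q i hpq y hy => ?_⟩
      have h1 := (c.strictMono_level hb (hI j) h).monotone (show -(q : ℤ) ≤ -(p : ℤ) by omega)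
      have h2 := (hK p q y hy).2
      rw [min_eq_right h1, max_eq_left h1] at h2
      exact ⟨hle i _ _ h2.2, hle i _ _ h2.1⟩
  refine le_polEntropy_of_le_sepCard (D := 2) (N := N * 2) (by omega) hε fun n hn => ?_
  have hcard : (Finset.range n ×ˢ Finset.range n).card = n ^ 2 := by simp [sq]
  rw [← hcard]
  refine card_le_sepCard _ (fun a => K a.1 (n + a.2)) hε ?_
  rintro ⟨p, q⟩ ha ⟨p', q'⟩ ha' hne'
  simp only [Finset.mem_product, Finset.mem_range] at ha ha'
  by_cases hp : p = p'
  · have hq : q ≠ q' := fun h => hne' (by rw [hp, h])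
    refine ⟨N * (n + q), by rw [mul_assoc]; exact Nat.mul_lt_mul_of_pos_left (by omega) hN, ?_⟩
    -- The bottom ends are compared as top ends for `-w`.
    refine le_dist_of_top_levels (w := fun y => -w y) (δ := δ)
      (fun y z h => ?_) f f.continuous (hK2 p (n + q)) (hK2 p' (n + q'))
      (fun y hy => neg_le_neg (hwK p (n + q) _ (by omega) y hy).2)
      (fun y hy => neg_le_neg (hwK p' (n + q') _ (by omega) y hy).2) ?_
    · rw [neg_sub_neg, hw, abs_sub_comm]
      exact hu j y z h
    · rw [neg_sub_neg, hw, hF, iterate_mul_eq_zpow, iterate_mul_eq_zpow]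
      exact hgap _ _ (by omega) (by omega)
  · refine ⟨N * p, by rw [mul_assoc]; exact Nat.mul_lt_mul_of_pos_left (by omega) hN, ?_⟩
    refine le_dist_of_top_levels (w := w) (δ := δ)
      (fun y z h => ?_) f f.continuous (hK1 p (n + q)) (hK1 p' (n + q'))
      (fun y hy => (hwK p (n + q) _ (by omega) y hy).1)
      (fun y hy => (hwK p' (n + q') _ (by omega) y hy).1) ?_
    · rw [hw]
      exact hu j y z h
    · rw [hw, hF, iterate_mul_eq_zpow, iterate_mul_eq_zpow]
      exact hgap _ _ (by omega) (by omega)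

theorem polEntropy_inducedMap (f : X ≃ₜ X) {N : ℕ} (hN : 1 ≤ N) (hb : (f ^ N) b = b)
    (hI : ∀ j x, (f ^ N) x ∈ I j ↔ x ∈ I j) {l : ℕ}
    (hl : {j : Fin k | ∃ x ∈ I j, (f ^ N) x ≠ x}.ncard = l) :
    (1 ≤ l → polEntropy (inducedMap f f.continuous) = ((max l 2 : ℕ) : EReal)) ∧
    (l = 0 → polEntropy (inducedMap f f.continuous) = 0) := by
  constructor
  · intro h1
    refine le_antisymm (c.polEntropy_inducedMap_le f hN hb hI hl (le_max_left _ _)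
      fun _ => le_max_right _ _) ?_
    rcases max_choice l 2 with h | h
    · rw [h]
      exact c.card_moved_le_polEntropy f hN hb hI hl
    · rw [h]
      obtain ⟨j, x, hx, hne⟩ : {j : Fin k | ∃ x ∈ I j, (f ^ N) x ≠ x}.Nonempty :=
        Set.nonempty_of_ncard_ne_zero (by omega)
      exact c.two_le_polEntropy f hN hb hI hx hne
  · rintro rfl
    have h1 := c.polEntropy_inducedMap_le f hN hb hI hl le_rfl (by omega)
    have h2 := c.card_moved_le_polEntropy f hN hb hI hl
    simpa using le_antisymm h1 h2

end StarChart

/-! ### Wandering points, the centre and the permutation of edges -/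

theorem IsWanderingPt.pow_apply_ne {X : Type*} [TopologicalSpace X] {f : X ≃ₜ X} {x : X}
    (h : IsWanderingPt f x) {N : ℕ} (hN : 1 ≤ N) : (f ^ N) x ≠ x := by
  intro hx
  obtain ⟨U, hU, h⟩ := h
  have hxU := mem_of_mem_nhds hU
  rw [Homeomorph.coe_pow_eq_iterate] at hx
  have : x ∈ f^[N] '' U ∩ U := ⟨⟨x, hxU, hx⟩, hxU⟩
  rw [h N hN] at this
  exact this

theorem isWanderingPt_of_open {X : Type*} [TopologicalSpace X] {f : X → X} {U : Set X}
    (hU : IsOpen U) (h : ∀ n : ℕ, 1 ≤ n → ∀ y ∈ U, f^[n] y ∉ U) {x : X} (hx : x ∈ U) :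
    IsWanderingPt f x := by
  refine ⟨U, hU.mem_nhds hx, fun n hn => eq_empty_iff_forall_notMem.2 ?_⟩
  rintro _ ⟨⟨y, hy, rfl⟩, hy'⟩
  exact h n hn y hy hy'

theorem pow_mem_edge_iff {X : Type*} [TopologicalSpace X] {k : ℕ} {I : Fin k → Set X} {f : X ≃ₜ X}
    {σ : Equiv.Perm (Fin k)}
    (hσ : ∀ j x, f x ∈ I (σ j) ↔ x ∈ I j) (n : ℕ) (j : Fin k) (x : X) :
    (f ^ n) x ∈ I ((σ ^ n) j) ↔ x ∈ I j := by
  induction n generalizing j x with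
  | zero => rfl
  | succ n ih => rw [pow_succ, pow_succ, Homeomorph.mul_apply, Equiv.Perm.mul_apply, ih, hσ]

namespace StarChart

variable {X : Type*} [TopologicalSpace X] {k : ℕ} {b : X} {I : Fin k → Set X} (c : StarChart b I)
include c

theorem e_one_ne_center (j : Fin k) : c.e j 1 ≠ b := by
  intro h
  have := c.u_e j 1
  rw [h, c.u_center] at this
  exact zero_ne_one this

theorem exists_subset_edge [T2Space X] {S : Set X} (hS : IsPreconnected S) (hb : b ∉ S) :
    ∃ j, S ⊆ I j := by
  rcases S.eq_empty_or_nonempty with rfl | ⟨x, hx⟩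
  · obtain ⟨j, -⟩ := c.exists_mem b
    exact ⟨j, empty_subset _⟩
  · obtain ⟨j, hj⟩ := c.exists_mem x
    exact ⟨j, c.subset_edge hS hb hx hj⟩

theorem isPreconnected_lt (j : Fin k) (s : unitInterval) : IsPreconnected {y | c.u j y < s} := by
  rcases eq_or_lt_of_le (show (0 : unitInterval) ≤ s from bot_le) with rfl | hs
  · have : {y | c.u j y < 0} = ∅ := eq_empty_iff_forall_notMem.2
      fun y (hy : c.u j y < 0) => not_lt_bot hy
    rw [this]
    exact isPreconnected_empty
  refine isPreconnected_of_forall b fun y hy => ?_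
  obtain ⟨i, hi⟩ := c.exists_mem y
  refine ⟨c.e i '' Icc 0 (c.u i y), ?_, ⟨0, ⟨le_rfl, bot_le⟩, c.e_zero i⟩,
    ⟨c.u i y, ⟨bot_le, le_rfl⟩, c.e_u i y hi⟩,
    isPreconnected_Icc.image _ (c.continuous_e i).continuousOn⟩
  rintro _ ⟨t, ht, rfl⟩
  change c.u j (c.e i t) < s
  by_cases hij : i = j
  · subst hij
    rw [c.u_e]
    exact ht.2.trans_lt hy
  · rw [c.u_eq_zero_of_mem hij (c.e_mem i t)]
    exact hs

theorem isPreconnected_gt (j : Fin k) (s : unitInterval) : IsPreconnected {y | s < c.u j y} := by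
  have : {y | s < c.u j y} = c.e j '' Ioi s := by
    ext y
    constructor
    · intro hy
      exact ⟨c.u j y, hy, c.e_u j y (c.mem_of_u_ne_zero (lt_of_le_of_lt bot_le hy).ne')⟩
    · rintro ⟨t, ht, rfl⟩
      change s < c.u j (c.e j t)
      rwa [c.u_e]
  rw [this]
  exact isPreconnected_Ioi.image _ (c.continuous_e j).continuousOn

/-- The centre of a star with at least three edges is a topological invariant. -/
theorem map_center [T2Space X] (hk : 3 ≤ k) (f : X ≃ₜ X) : f b = b := by
  by_contra hne
  obtain ⟨j, hj⟩ := c.exists_mem (f b)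
  have hpre : ∀ {S : Set X}, IsPreconnected S → f b ∉ S → ∃ i, f.symm '' S ⊆ I i := fun hS hb =>
    c.exists_subset_edge (hS.image _ f.symm.continuous.continuousOn) (by
      rintro ⟨y, hy, hyb⟩
      rw [Homeomorph.symm_apply_eq] at hyb
      exact hb (hyb ▸ hy))
  -- Removing `f b` from the star leaves two connected sets, one possibly empty. Their preimages
  -- avoid `b`, so they lie in two edges; the outer end of a third edge is then unaccounted for.
  obtain ⟨i₁, h1⟩ := hpre (c.isPreconnected_lt j (c.u j (f b))) (lt_irrefl (c.u j (f b)))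
  obtain ⟨i₂, h2⟩ := hpre (c.isPreconnected_gt j (c.u j (f b))) (lt_irrefl (c.u j (f b)))
  obtain ⟨i, hi⟩ : ∃ i : Fin k, i ∉ ({i₁, i₂} : Finset (Fin k)) := by
    by_contra! h
    have h3 : (Finset.univ : Finset (Fin k)).card ≤ ({i₁, i₂} : Finset (Fin k)).card :=
      Finset.card_le_card fun i _ => h i
    rw [Finset.card_univ, Fintype.card_fin] at h3
    have := Finset.card_le_two (a := i₁) (b := i₂)
    omega
  simp only [Finset.mem_insert, Finset.mem_singleton, not_or] at hi
  set z := c.e i 1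
  have hz : f.symm (f z) = z := f.symm_apply_apply z
  rcases lt_trichotomy (c.u j (f z)) (c.u j (f b)) with h | h | h
  · exact c.e_one_ne_center i (c.eq_center i i₁ hi.1 z (c.e_mem i 1)
      (h1 ⟨f z, h, hz⟩))
  · have h0 : c.u j (f b) ≠ 0 := fun h0 => hne ((c.u_eq_zero_iff hj).1 h0)
    exact c.e_one_ne_center i (f.injective (c.u_injOn j (c.mem_of_u_ne_zero (h ▸ h0)) hj h))
  · exact c.e_one_ne_center i (c.eq_center i i₂ hi.2 z (c.e_mem i 1)
      (h2 ⟨f z, h, hz⟩))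

theorem exists_mapsTo_edge [T2Space X] (f : X ≃ₜ X) (hb : f b = b) (j : Fin k) :
    ∃ i, ∀ x ∈ I j, f x ∈ I i := by
  obtain ⟨i, hi⟩ := c.exists_subset_edge
    ((c.isPreconnected_gt j 0).image f f.continuous.continuousOn) (by
      rintro ⟨y, hy, hyb⟩
      have : y = b := f.injective (hyb.trans hb.symm)
      have hy : 0 < c.u j y := hy
      rw [this, c.u_center] at hy
      exact lt_irrefl _ hy)
  refine ⟨i, fun x hx => ?_⟩
  by_cases h : x = b
  · rw [h, hb]
    exact c.center_mem i
  · exact hi ⟨x, lt_of_le_of_ne bot_le fun h0 => h ((c.u_eq_zero_iff hx).1 h0.symm), rfl⟩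

/-- A homeomorphism of a star fixing the centre permutes the edges. -/
theorem exists_perm [T2Space X] (f : X ≃ₜ X) (hb : f b = b) :
    ∃ σ : Equiv.Perm (Fin k), ∀ j x, f x ∈ I (σ j) ↔ x ∈ I j := by
  choose σ hσ using c.exists_mapsTo_edge f hb
  have hb' : f.symm b = b := by rw [Homeomorph.symm_apply_eq, hb]
  choose τ hτ using c.exists_mapsTo_edge f.symm hb'
  have hτσ : Function.LeftInverse τ σ := by
    intro j
    by_contra hne
    have h := hτ _ _ (hσ j _ (c.e_mem j 1))
    rw [f.symm_apply_apply] at h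
    exact c.e_one_ne_center j (c.eq_center _ j hne _ h (c.e_mem j 1))
  refine ⟨Equiv.ofBijective σ (Finite.injective_iff_bijective.1 hτσ.injective), fun j x =>
    ⟨fun h => ?_, hσ j x⟩⟩
  change f x ∈ I (σ j) at h
  have := hτ _ _ h
  rwa [f.symm_apply_apply, hτσ] at this

/-- Wandering points are not periodic. Conversely let `r` be the period of the edge under `σ`: the
open interval between `x` and `(f ^ r) x` never returns under powers of `f ^ r`, and at all other
times its image lies in a different edge, which meets `I j` only in `b`. -/
theorem exists_wandering_iff [T2Space X] {f : X ≃ₜ X} (hb : f b = b) {σ : Equiv.Perm (Fin k)}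
    (hσ : ∀ j x, f x ∈ I (σ j) ↔ x ∈ I j) (j : Fin k) :
    (∃ x ∈ I j, IsWanderingPt f x) ↔ ∃ x ∈ I j, (f ^ orderOf σ) x ≠ x := by
  constructor
  · rintro ⟨x, hx, hw⟩
    exact ⟨x, hx, hw.pow_apply_ne (orderOf_pos σ)⟩
  · rintro ⟨x, hx, hne⟩
    set r := Function.minimalPeriod σ j with hr
    have hdvd : r ∣ orderOf σ := by
      refine Function.IsPeriodicPt.minimalPeriod_dvd ?_
      rw [Function.IsPeriodicPt, Function.IsFixedPt, Equiv.Perm.iterate_eq_pow, pow_orderOf_eq_one]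
      rfl
    have hσr : (σ ^ r) j = j := by
      rw [← Equiv.Perm.iterate_eq_pow]
      exact Function.isPeriodicPt_minimalPeriod σ j
    have hG : ∀ x, (f ^ r) x ∈ I j ↔ x ∈ I j := fun x => by
      have := pow_mem_edge_iff hσ r j x
      rwa [hσr] at this
    have hGb : (f ^ r) b = b := by
      rw [Homeomorph.coe_pow_eq_iterate]
      exact Function.iterate_fixed hb r
    have hGx : (f ^ r) x ≠ x := by
      intro h
      obtain ⟨m, hm⟩ := hdvd
      rw [hm, pow_mul, Homeomorph.coe_pow_eq_iterate (f ^ r)] at hne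
      exact hne (Function.iterate_fixed h m)
    obtain ⟨U, hU, ⟨y, hy⟩, hUI, hbU, hUn, -⟩ := c.exists_open_of_moved hGb hG hx hGx
    refine ⟨y, hUI hy, isWanderingPt_of_open hU (fun n hn z hz hz' => ?_) hy⟩
    rw [← Homeomorph.coe_pow_eq_iterate] at hz'
    by_cases hn' : (σ ^ n) j = j
    · have hrn : r ∣ n := by
        refine Function.IsPeriodicPt.minimalPeriod_dvd ?_
        rwa [Function.IsPeriodicPt, Function.IsFixedPt, Equiv.Perm.iterate_eq_pow]
      obtain ⟨m, rfl⟩ := hrn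
      rw [pow_mul] at hz'
      exact hUn m (Nat.pos_of_ne_zero fun h => by simp [h] at hn) z hz hz'
    · have := c.eq_center _ _ hn' _ ((pow_mem_edge_iff hσ n j z).2 (hUI hz)) (hUI hz')
      exact hbU (this ▸ hz')

end StarChart

/-- The formula for homeomorphisms of a star that fix its centre. -/
theorem polEntropy_inducedMap_of_map_center {X : Type*} [MetricSpace X] [CompactSpace X] {k : ℕ}
    {b : X} {I : Fin k → Set X} (c : StarChart b I) (f : X ≃ₜ X) (hb : f b = b) {l : ℕ}
    (hl : {j : Fin k | ∃ x ∈ I j, IsWanderingPt f x}.ncard = l) :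
    (1 ≤ l → polEntropy (inducedMap f f.continuous) = ((max l 2 : ℕ) : EReal)) ∧
    (l = 0 → polEntropy (inducedMap f f.continuous) = 0) := by
  obtain ⟨σ, hσ⟩ := c.exists_perm f hb
  refine c.polEntropy_inducedMap f (N := orderOf σ) (orderOf_pos σ) ?_ ?_ ?_
  · rw [Homeomorph.coe_pow_eq_iterate]
    exact Function.iterate_fixed hb _
  · intro j x
    have := pow_mem_edge_iff hσ (orderOf σ) j x
    rwa [pow_orderOf_eq_one] at this
  · simp only [← c.exists_wandering_iff hb hσ]
    exact hl

/-! ### Stars with at most two edges: arcs -/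

section Arc

variable {X : Type*} [TopologicalSpace X] {b : X}

/-- An arc is a star with a single edge. -/
theorem isStar_univ_of_homeomorph (θ : unitInterval ≃ₜ X) :
    IsStar (θ 0) (fun _ : Fin 1 => (univ : Set X)) where
  arc _ := ⟨θ.trans (Homeomorph.Set.univ X).symm, rfl⟩
  inter i j hij := absurd (Subsingleton.elim i j) hij
  cover := iUnion_const univ

/-- A star with two edges is an arc. -/
theorem StarChart.nonempty_homeomorph [CompactSpace X] [T2Space X] {I : Fin 2 → Set X}
    (c : StarChart b I) : Nonempty (unitInterval ≃ₜ X) := by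
  have hzero : ∀ x, c.u 0 x = 0 ∨ c.u 1 x = 0 := fun x => by
    by_contra! h
    have h0 := c.mem_of_u_ne_zero h.1
    have := c.eq_center 0 1 (by decide) x h0 (c.mem_of_u_ne_zero h.2)
    exact h.1 ((c.u_eq_zero_iff h0).2 this)
  have hinj : ∀ x y, c.u 0 x = c.u 0 y → c.u 1 x = c.u 1 y → x = y := by
    intro x y h0 h1
    by_cases hb : c.u 0 x = 0 ∧ c.u 1 x = 0
    · have hcen : ∀ z, c.u 0 z = 0 → c.u 1 z = 0 → z = b := fun z hz0 hz1 => by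
        obtain ⟨j, hj⟩ := c.exists_mem z
        refine (c.u_eq_zero_iff hj).1 ?_
        fin_cases j
        · exact hz0
        · exact hz1
      rw [hcen x hb.1 hb.2, hcen y (h0 ▸ hb.1) (h1 ▸ hb.2)]
    · rcases not_and_or.1 hb with h | h
      · exact c.u_injOn 0 (c.mem_of_u_ne_zero h) (c.mem_of_u_ne_zero (h0 ▸ h)) h0
      · exact c.u_injOn 1 (c.mem_of_u_ne_zero h) (c.mem_of_u_ne_zero (h1 ▸ h)) h1
  have hrange : ∀ x, (c.u 1 x : ℝ) - c.u 0 x ∈ Icc (-1 : ℝ) 1 := fun x => by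
    have h0 := (c.u 0 x).2
    have h1 := (c.u 1 x).2
    constructor <;> linarith [h0.1, h0.2, h1.1, h1.2]
  -- At most one of the two levels is nonzero, so their difference lays the edges end to end with
  -- `b` at 0.
  let ψ : X → Icc (-1 : ℝ) 1 := fun x => ⟨(c.u 1 x : ℝ) - c.u 0 x, hrange x⟩
  have hψ : Continuous ψ := by
    refine Continuous.subtype_mk ?_ _
    exact (continuous_subtype_val.comp (c.continuous_u 1)).sub
      (continuous_subtype_val.comp (c.continuous_u 0))
  have hbij : Function.Bijective ψ := by
    constructor
    · intro x y h
      have h : (c.u 1 x : ℝ) - c.u 0 x = c.u 1 y - c.u 0 y := congrArg Subtype.val h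
      have hx0 := (c.u 0 x).2.1
      have hx1 := (c.u 1 x).2.1
      have hy0 := (c.u 0 y).2.1
      have hy1 := (c.u 1 y).2.1
      refine hinj x y (Subtype.ext ?_) (Subtype.ext ?_) <;>
        rcases hzero x with hx | hx <;> rcases hzero y with hy | hy <;>
        simp only [hx, hy, Set.Icc.coe_zero] at h ⊢ <;> linarith
    · rintro ⟨t, ht⟩
      rcases le_total 0 t with h | h
      · refine ⟨c.e 1 ⟨t, h, ht.2⟩, Subtype.ext ?_⟩
        simp only [ψ, c.u_e, c.u_eq_zero_of_mem (show (1 : Fin 2) ≠ 0 by decide) (c.e_mem 1 _)]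
        simp
      · refine ⟨c.e 0 ⟨-t, by linarith, by linarith [ht.1]⟩, Subtype.ext ?_⟩
        simp only [ψ, c.u_e, c.u_eq_zero_of_mem (show (0 : Fin 2) ≠ 1 by decide) (c.e_mem 0 _)]
        simp
  let Ψ : X ≃ₜ Icc (-1 : ℝ) 1 :=
    Continuous.homeoOfEquivCompactToT2 (f := Equiv.ofBijective ψ hbij) hψ
  exact ⟨(Ψ.trans (iccHomeoI (-1 : ℝ) 1 (by norm_num))).symm⟩

namespace StarChart

variable (c : StarChart b (fun _ : Fin 1 => (univ : Set X)))
include c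

/-- A homeomorphism of an arc either preserves or reverses the order. -/
theorem monotone_or_antitone (f : X ≃ₜ X) :
    f b = b ∨ ((f ^ 2) b = b ∧ ∀ x y, c.u 0 x < c.u 0 y → c.u 0 (f y) < c.u 0 (f x)) := by
  have heu : ∀ x, c.e 0 (c.u 0 x) = x := fun x => c.e_u 0 x (mem_univ x)
  have hcont : Continuous fun s => c.u 0 (f (c.e 0 s)) :=
    (c.continuous_u 0).comp (f.continuous.comp (c.continuous_e 0))
  have hinj : Function.Injective fun s => c.u 0 (f (c.e 0 s)) := by
    intro s t h
    have := f.injective (c.u_injOn 0 (mem_univ _) (mem_univ _) h)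
    rw [← c.u_e 0 s, this, c.u_e]
  have hsurj : ∀ t, ∃ s, c.u 0 (f (c.e 0 s)) = t := fun t =>
    ⟨c.u 0 (f.symm (c.e 0 t)), by rw [heu, f.apply_symm_apply, c.u_e]⟩
  rcases hcont.strictMono_of_inj_boundedOrder' hinj with h | h
  · left
    obtain ⟨s, hs⟩ := hsurj 0
    have h1 : c.u 0 (f (c.e 0 0)) ≤ c.u 0 (f (c.e 0 s)) := h.monotone bot_le
    rw [hs, c.e_zero] at h1
    exact (c.u_eq_zero_iff (mem_univ _)).1 (le_antisymm h1 bot_le)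
  · right
    constructor
    · obtain ⟨s, hs⟩ := hsurj 1
      have h1 : c.u 0 (f (c.e 0 s)) ≤ c.u 0 (f (c.e 0 0)) := h.antitone bot_le
      rw [hs, c.e_zero] at h1
      have h2 : f b = c.e 0 1 := by
        rw [← heu (f b), le_antisymm le_top h1]
        rfl
      obtain ⟨t, ht⟩ := hsurj 0
      have h3 : c.u 0 (f (c.e 0 1)) ≤ c.u 0 (f (c.e 0 t)) := h.antitone le_top
      rw [ht] at h3
      rw [pow_two, Homeomorph.mul_apply, h2]
      exact (c.u_eq_zero_iff (mem_univ _)).1 (le_antisymm h3 bot_le)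
    · intro x y hxy
      have := h hxy
      simpa only [heu] using this

theorem sq_map_endpoint (f : X ≃ₜ X) : (f ^ 2) b = b := by
  rcases c.monotone_or_antitone f with h | h
  · rw [pow_two, Homeomorph.mul_apply, h, h]
  · exact h.1

theorem exists_fixed (f : X ≃ₜ X) : ∃ z, f z = z := by
  obtain ⟨s, -, hs⟩ := exists_mem_Icc_isFixedPt_of_mapsTo (a := (0 : unitInterval)) (b := 1)
    (f := fun s => c.u 0 (f (c.e 0 s)))
    ((c.continuous_u 0).comp (f.continuous.comp (c.continuous_e 0))).continuousOn bot_le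
    (fun s _ => ⟨bot_le, le_top⟩)
  refine ⟨c.e 0 s, c.u_injOn 0 (mem_univ _) (mem_univ _) ?_⟩
  rw [c.u_e]
  exact hs

/-- If `f` reverses the arc, the open interval between `x` and `(f ^ 2) x` lies on one side of a
fixed point `z`. Odd iterates carry it to the other side of `z`, and even ones are powers of `f ^
2`, under which it never returns. -/
theorem exists_wandering_of_sq_ne (f : X ≃ₜ X) {x : X} (hx : (f ^ 2) x ≠ x) :
    ∃ y, IsWanderingPt f y := by
  rcases c.monotone_or_antitone f with hb | ⟨hb, hanti⟩
  · have hfx : f x ≠ x := fun h => hx (by rw [pow_two, Homeomorph.mul_apply, h, h])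
    obtain ⟨U, hU, ⟨y, hy⟩, -, -, hUn, -⟩ :=
      c.exists_open_of_moved (j := 0) hb (fun _ => Iff.rfl) (mem_univ x) hfx
    refine ⟨y, isWanderingPt_of_open hU (fun n hn z hz => ?_) hy⟩
    rw [← Homeomorph.coe_pow_eq_iterate]
    exact hUn n hn z hz
  · obtain ⟨z, hz⟩ := c.exists_fixed f
    set F := f ^ 2 with hF
    have hFz : F z = z := by rw [hF, pow_two, Homeomorph.mul_apply, hz, hz]
    have hlt : ∀ p q, c.u 0 p < c.u 0 q → c.u 0 (F p) < c.u 0 (F q) := fun p q h => by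
      rw [hF, pow_two]
      exact hanti _ _ (hanti _ _ h)
    have hlt' : ∀ (m : ℕ) p q, c.u 0 p < c.u 0 q → c.u 0 ((F ^ m) p) < c.u 0 ((F ^ m) q) := by
      intro m
      induction m with
      | zero => exact fun p q h => h
      | succ m ih =>
        intro p q h
        rw [pow_succ]
        exact ih _ _ (hlt p q h)
    have hzm : ∀ m : ℕ, (F ^ m) z = z := fun m => by
      rw [Homeomorph.coe_pow_eq_iterate]
      exact Function.iterate_fixed hFz m
    obtain ⟨U, hU, ⟨y, hy⟩, -, -, hUn, hUb⟩ :=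
      c.exists_open_of_moved (j := 0) hb (fun _ => Iff.rfl) (mem_univ x) hx
    have hside : (∀ y ∈ U, c.u 0 y < c.u 0 z) ∨ (∀ y ∈ U, c.u 0 z < c.u 0 y) := by
      rcases lt_trichotomy (c.u 0 x) (c.u 0 z) with h | h | h
      · have h' := hlt _ _ h
        rw [hFz] at h'
        exact Or.inl fun y hy => (hUb y hy).elim (fun h1 => h1.2.trans h') fun h1 => h1.2.trans h
      · have : x = z := c.u_injOn 0 (mem_univ _) (mem_univ _) h
        rw [this] at hx
        exact absurd hFz hx
      · have h' := hlt _ _ h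
        rw [hFz] at h'
        exact Or.inr fun y hy => (hUb y hy).elim (fun h1 => h.trans h1.1) fun h1 => h'.trans h1.1
    refine ⟨y, isWanderingPt_of_open hU (fun n hn p hp hp' => ?_) hy⟩
    rw [← Homeomorph.coe_pow_eq_iterate] at hp'
    rcases Nat.even_or_odd' n with ⟨m, rfl | rfl⟩
    · rw [pow_mul] at hp'
      exact hUn m (by omega) p hp hp'
    · rw [pow_succ', pow_mul, Homeomorph.mul_apply] at hp'
      rcases hside with h | h
      · have h1 := hlt' m _ _ (h p hp)
        have h2 := hanti _ _ h1
        rw [hzm, hz] at h2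
        exact absurd (h _ hp') h2.not_gt
      · have h1 := hlt' m _ _ (h p hp)
        have h2 := hanti _ _ h1
        rw [hzm, hz] at h2
        exact absurd (h _ hp') h2.not_gt

end StarChart

end Arc

theorem StarChart.polEntropy_inducedMap_arc {X : Type*} [MetricSpace X] [CompactSpace X] {b : X}
    (c : StarChart b (fun _ : Fin 1 => (univ : Set X))) (f : X ≃ₜ X) :
    ((∃ x, IsWanderingPt f x) → polEntropy (inducedMap f f.continuous) = 2) ∧
    ((¬ ∃ x, IsWanderingPt f x) → polEntropy (inducedMap f f.continuous) = 0) := by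
  have key := fun l => c.polEntropy_inducedMap f (N := 2) (by norm_num) (c.sq_map_endpoint f)
    (fun _ _ => Iff.rfl) (l := l)
  constructor
  · rintro ⟨x, hx⟩
    have h1 : {j : Fin 1 | ∃ x ∈ (univ : Set X), (f ^ 2) x ≠ x}.ncard = 1 := by
      have : {j : Fin 1 | ∃ x ∈ (univ : Set X), (f ^ 2) x ≠ x} = univ :=
        eq_univ_of_forall fun _ => ⟨x, mem_univ x, hx.pow_apply_ne (by norm_num)⟩
      rw [this]
      simp
    simpa using (key 1 h1).1 le_rfl
  · intro hx
    have h0 : {j : Fin 1 | ∃ x ∈ (univ : Set X), (f ^ 2) x ≠ x}.ncard = 0 := by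
      have : {j : Fin 1 | ∃ x ∈ (univ : Set X), (f ^ 2) x ≠ x} = ∅ :=
        eq_empty_iff_forall_notMem.2 fun _ ⟨x, _, h⟩ => hx (c.exists_wandering_of_sq_ne f h)
      rw [this]
      simp
    exact (key 0 h0).2 rfl

/-! ### The main theorem -/

theorem mainTheorem7 {X : Type*} [MetricSpace X] [CompactSpace X] {k : ℕ} (hk : 1 ≤ k)
    (b : X) (I : Fin k → Set X) (hX : IsStar b I) (f : X ≃ₜ X) (l : ℕ)
    (hl : {j : Fin k | ∃ x ∈ I j, IsWanderingPt f x}.ncard = l) :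
    (1 ≤ l → polEntropy (inducedMap f f.continuous) = ((max l 2 : ℕ) : EReal)) ∧
    (l = 0 → polEntropy (inducedMap f f.continuous) = 0) := by
  obtain ⟨c⟩ := hX.nonempty_chart
  by_cases hk3 : 3 ≤ k
  · exact polEntropy_inducedMap_of_map_center c f (c.map_center hk3 f) hl
  -- With at most two edges the centre need not be fixed, so the star is rebased at an endpoint of
  -- the arc.
  have harc : ∃ b' : X, Nonempty (StarChart b' (fun _ : Fin 1 => (univ : Set X))) := by
    obtain rfl | rfl : k = 1 ∨ k = 2 := by omega
    · have : I = fun _ => univ := by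
        funext j
        refine eq_univ_of_forall fun x => ?_
        obtain ⟨i, hi⟩ := c.exists_mem x
        rwa [Subsingleton.elim j i]
      subst this
      exact ⟨b, ⟨c⟩⟩
    · obtain ⟨θ⟩ := c.nonempty_homeomorph
      exact ⟨θ 0, (isStar_univ_of_homeomorph θ).nonempty_chart⟩
  obtain ⟨b', ⟨c'⟩⟩ := harc
  -- As `max l 2 = 2` here, only the existence of a wandering point matters, and this does not
  -- depend on the decomposition into edges.
  have hlk : l ≤ 2 := by
    have := Set.ncard_le_card {j : Fin k | ∃ x ∈ I j, IsWanderingPt f x}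
    rw [Nat.card_fin] at this
    omega
  have hiff : 1 ≤ l ↔ ∃ x, IsWanderingPt f x := by
    rw [← hl, Nat.one_le_iff_ne_zero, ← Nat.pos_iff_ne_zero, Set.ncard_pos]
    constructor
    · rintro ⟨j, x, -, hx⟩
      exact ⟨x, hx⟩
    · rintro ⟨x, hx⟩
      obtain ⟨j, hj⟩ := c.exists_mem x
      exact ⟨j, x, hj, hx⟩
  constructor
  · intro h
    rw [max_eq_right hlk]
    exact (c'.polEntropy_inducedMap_arc f).1 (hiff.1 h)
  · intro h
    exact (c'.polEntropy_inducedMap_arc f).2 fun hx => by have := hiff.2 hx; omega
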